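/- **Instruction sequences.** Basic instructions are $\mathsf{in{:}}i.\mathsf{get}$, $\mathsf{out.set{:}}b$, $\mathsf{aux{:}}i.\mathsf{get}$ and $\mathsf{aux{:}}i.\mathsf{set{:}}b$ with $i\ge 1$, $b\in\{0,1\}$. Primitive instructions are $a$, $+a$, $-a$ (for a basic instruction $a$), the forward jumps $\#l$ ($l\in\mathbb N$), and the halt instruction $!$. An instruction sequence $X$ is a finite sequence of primitive instructions and $\mathrm{len}(X)$ is its length. $\mathsf{get}$ replies the content of the register; $\mathsf{set{:}}b$ makes the content $b$ and replies $b$. Execution starts at the first instruction. After $a$ execution proceeds with the next instruction. After $+a$ (respectively $-a$) it does so if the reply is $1$ (respectively $0$), and otherwise the next instruction is skipped. After $\#l$ it proceeds with the $l$-th next instruction. At $!$ it terminates. If $l=0$, if there is no instruction to proceed with, or if the register used is absent, execution does not terminate. $X$ *computes* $f:\{0,1\}^n\to\{0,1\}$ if for some $k$, for all $b_1,\dots,b_n\in\{0,1\}$, execution of $X$ with registers $\mathsf{in{:}}1,\dots,\mathsf{in{:}}n$, $\mathsf{out}$, $\mathsf{aux{:}}1,\dots,\mathsf{aux{:}}k$,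 where initially $\mathsf{in{:}}i$ contains $b_i$ and the other registers contain $0$, terminates with $f(b_1,\dots,b_n)$ in $\mathsf{out}$. Let $\mathrm{NZT}_n(b_1,\dots,b_n)=1$ iff some $b_i=1$. Let $\mathrm{TSTNZ}'_n$ be the following instruction sequence. If $n$ is even, it is the concatenation over $j=1,\dots,n/2$ of $-\mathsf{in{:}}(2j{-}1).\mathsf{get}\,;\,+\mathsf{in{:}}2j.\mathsf{get}\,;\,\mathsf{out.set{:}}1$, followed by $!$. If $n$ is odd, it is $+\mathsf{in{:}}1.\mathsf{get}\,;\,\mathsf{out.set{:}}1$, followed by the concatenation over $j=1,\dots,(n-1)/2$ of $-\mathsf{in{:}}2j.\mathsf{get}\,;\,+\mathsf{in{:}}(2j{+}1).\mathsf{get}\,;\,\mathsf{out.set{:}}1$, followed by $!$. Its length is $3n/2+1$ for even $n$ and $3(n+1)/2$ for odd $n$. A *read instruction* is $+\mathsf{in{:}}i.\mathsf{get}$ or $-\mathsf{in{:}}i.\mathsf{get}$, and $\mathrm{iregs}(X)$ is the set of all $i$ for which such an instruction occurs in $X$. $X$ is *good* if it is of the form $Y\,;\,\mathsf{out.set{:}}1\,;\,!$,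 where $Y$ is non-empty and consists only of read instructions and jumps $\#l$ with $l>0$. **Machine model.** A RAM has a program, registers $x_0,x_1,\dots$ that hold integers (initially $0$), a read-only input tape of integers and a write-only output tape. Its instructions are $x_i:=c$, $x_i:=x_j+x_k$, $x_i:=x_j-x_k$, $x_i:=x_{x_j}$, $x_{x_i}:=x_j$, jump if $x_j>0$, read, and print (no multiplication or division); each executed instruction costs one unit of time. An instruction sequence is given on the input tape with two integers per primitive instruction: a code for its form, and the natural number in it, or $-1$ if there is none. **Theorem.** The problem of deciding whether an instruction sequence $X$ such that $X$ is good, $\mathrm{len}(X)=\mathrm{len}(\mathrm{TSTNZ}'_n)+m$ and $\mathrm{iregs}(X)=\{1,\dots,n\}$ computes $\mathrm{NZT}_n$, for integers $n,m\ge1$, can be solved in $O\bigl(2^{6m}(n+m)+n(n+m)\bigr)$ time on a RAM. That is, there are one RAM program and one constant $C$ such that, for all $n,m\ge 1$ and every such $X$, the program on input $X$ halts within $C\,\bigl(2^{6m}(n+m)+n(n+m)\bigr)$ steps and prints $1$ if $X$ computes $\mathrm{NZT}_n$ and $0$ otherwise. -/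

import Mathlib

/-! # Finite instruction sequences over Boolean registers -/

namespace InSeq

/-- Basic instructions: `in:i.get`, `out.set:b`, `aux:i.get`, `aux:i.set:b`. -/
inductive BInstr : Type
  | inGet (i : ℕ+)
  | outSet (b : Bool)
  | auxGet (i : ℕ+)
  | auxSet (i : ℕ+) (b : Bool)

/-- Primitive instructions: plain basic instruction `a`, positive test `+a`, negative test `-a`,
forward jump `#l`, and termination `!`. -/
inductive PInstr : Type
  | plain (a : BInstr)
  | pos (a : BInstr)
  | neg (a : BInstr)
  | jump (l : ℕ)
  | halt

/-- Finite instruction sequences. -/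
abbrev InstrSeq : Type := List PInstr

/-- Contents of the registers of an environment with input registers `in:1, …, in:n`,
output register `out` and auxiliary registers `aux:1, …, aux:k`.
The register with number `i` has index `i - 1`. -/
structure Env (n k : ℕ) : Type where
  inp : Fin n → Bool
  out : Bool
  aux : Fin k → Bool

/-- Effect of a basic instruction: the reply and the new contents, or `none`
if the named register is not present in the environment. -/
def BInstr.exec {n k : ℕ} (a : BInstr) (e : Env n k) : Option (Bool × Env n k) :=
  match a with
  | .inGet i => if h : i.natPred < n then some (e.inp ⟨i.natPred, h⟩, e) else none
  | .outSet b => some (b, { e with out := b })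
  | .auxGet i => if h : i.natPred < k then some (e.aux ⟨i.natPred, h⟩, e) else none
  | .auxSet i b =>
      if h : i.natPred < k then
        some (b, { e with aux := Function.update e.aux ⟨i.natPred, h⟩ b })
      else none

/-- `run s X e` executes, in environment `e`, what remains of `X` after dropping its first `s`
instructions. The result is the environment on termination; it is `none` if execution does not
terminate properly (there is no instruction to proceed with, a jump `#0` is executed, or an absent
register is used). -/
def run {n k : ℕ} : ℕ → InstrSeq → Env n k → Option (Env n k)
  | _, [], _ => none
  | s + 1, _ :: X, e => run s X e
  | 0, u :: X, e =>
      match u with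
      | .plain a =>
          match a.exec e with
          | some (_, e') => run 0 X e'
          | none => none
      | .pos a =>
          match a.exec e with
          | some (true, e') => run 0 X e'
          | some (false, e') => run 1 X e'
          | none => none
      | .neg a =>
          match a.exec e with
          | some (true, e') => run 1 X e'
          | some (false, e') => run 0 X e'
          | none => none
      | .jump 0 => none
      | .jump (l + 1) => run l X e
      | .halt => some e

/-- `X` computes the function `f : {0,1}ⁿ → {0,1}`. -/
def Computes {n : ℕ} (X : InstrSeq) (f : (Fin n → Bool) → Bool) : Prop :=
  ∃ k : ℕ, ∀ b : Fin n → Bool, ∃ e : Env n k,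
    run 0 X { inp := b, out := false, aux := fun _ => false } = some e ∧ e.out = f b

/-- The non-zeroness test on `n` bits. -/
def nzt (n : ℕ) (b : Fin n → Bool) : Bool := decide (∃ i, b i = true)

/-- `+in:i.get` -/
abbrev posRead (i : ℕ+) : PInstr := .pos (.inGet i)

/-- `-in:i.get` -/
abbrev negRead (i : ℕ+) : PInstr := .neg (.inGet i)

/-- `out.set:1` -/
abbrev setOut : PInstr := .plain (.outSet true)

/-- The shortest non-zeroness test sequence:
for even `n`, the sequences `-in:(2j-1).get ; +in:(2j).get ; out.set:1` for `j = 1, …, n/2`,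
followed by `!`; for odd `n`, the sequence `+in:1.get ; out.set:1`, followed by
`-in:(2j).get ; +in:(2j+1).get ; out.set:1` for `j = 1, …, (n-1)/2`, followed by `!`.
(In the code `j` is counted from `0`.) -/
def nztShort (n : ℕ) : InstrSeq :=
  if n % 2 = 0 then
    (List.range (n / 2)).flatMap
      (fun j => [negRead (2 * j).succPNat, posRead (2 * j + 1).succPNat, setOut]) ++ [.halt]
  else
    [posRead 1, setOut] ++
      (List.range ((n - 1) / 2)).flatMap
        (fun j => [negRead (2 * j + 1).succPNat, posRead (2 * j + 2).succPNat, setOut]) ++ [.halt]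

/-- The numbers of the input registers read by some read instruction `+in:i.get` or `-in:i.get`
occurring in `X`. -/
def iregs (X : InstrSeq) : Set ℕ+ := {i | posRead i ∈ X ∨ negRead i ∈ X}

/-- Good instruction sequences: `Y ; out.set:1 ; !` where `Y` is a (non-empty) sequence of read
instructions and forward jumps `#l` with `l > 0`. -/
def Good (X : InstrSeq) : Prop :=
  ∃ Y : InstrSeq, Y ≠ [] ∧ X = Y ++ [setOut, .halt] ∧
    ∀ u ∈ Y, (∃ i, u = posRead i ∨ u = negRead i) ∨ ∃ l, 0 < l ∧ u = .jump l

/-! ## Representation by integers: each primitive instruction is represented by two integers, one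
for its form and one for the natural number in it (`-1` if there is none). -/

/-- Form of a basic instruction, as a number below 6. -/
def BInstr.form : BInstr → ℤ
  | .inGet _ => 0
  | .outSet false => 1
  | .outSet true => 2
  | .auxGet _ => 3
  | .auxSet _ false => 4
  | .auxSet _ true => 5

/-- Register number of a basic instruction, `-1` if there is none. -/
def BInstr.num : BInstr → ℤ
  | .inGet i => ((i : ℕ) : ℤ)
  | .outSet _ => -1
  | .auxGet i => ((i : ℕ) : ℤ)
  | .auxSet i _ => ((i : ℕ) : ℤ)

/-- The two integers that represent a primitive instruction. -/
def PInstr.code : PInstr → List ℤ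
  | .halt => [1, -1]
  | .jump l => [2, (l : ℤ)]
  | .plain a => [3 + a.form, a.num]
  | .pos a => [9 + a.form, a.num]
  | .neg a => [15 + a.form, a.num]

/-- The input tape that represents an instruction sequence. -/
def encode (X : InstrSeq) : List ℤ := X.flatMap PInstr.code

end InSeq

/-! # Random access machines (without multiplication and division), uniform cost -/

namespace Ram

/-- Instructions of a RAM with memory registers `x 0, x 1, x 2, …` holding integers. -/
inductive Instr : Type
  /-- `x i := c` -/
  | const (i : ℕ) (c : ℤ)
  /-- `x i := x j + x k` -/
  | add (i j k : ℕ)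
  /-- `x i := x j - x k` -/
  | sub (i j k : ℕ)
  /-- `x i := x (x j)` -/
  | load (i j : ℕ)
  /-- `x (x i) := x j` -/
  | store (i j : ℕ)
  /-- transfer control to instruction number `m` if `x j > 0` -/
  | jumpPos (m j : ℕ)
  /-- read the next integer from the input tape into `x i` -/
  | read (i : ℕ)
  /-- print `x i` on the output tape -/
  | print (i : ℕ)

/-- A RAM program; instructions are numbered from `0`. -/
abbrev Program : Type := List Instr

/-- Configurations: program counter, memory, remaining input, output so far. -/
structure Config : Type where
  pc : ℕ
  mem : ℕ → ℤ
  input : List ℤ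
  output : List ℤ

/-- Execution of a single instruction; `none` if an indirect address is negative.
Beyond the end of the input, `0` is read. -/
def Instr.exec (I : Instr) (c : Config) : Option Config :=
  match I with
  | .const i v => some { c with pc := c.pc + 1, mem := Function.update c.mem i v }
  | .add i j k =>
      some { c with pc := c.pc + 1, mem := Function.update c.mem i (c.mem j + c.mem k) }
  | .sub i j k =>
      some { c with pc := c.pc + 1, mem := Function.update c.mem i (c.mem j - c.mem k) }
  | .load i j =>
      if 0 ≤ c.mem j then
        some { c with pc := c.pc + 1, mem := Function.update c.mem i (c.mem (c.mem j).toNat) }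
      else none
  | .store i j =>
      if 0 ≤ c.mem i then
        some { c with pc := c.pc + 1, mem := Function.update c.mem (c.mem i).toNat (c.mem j) }
      else none
  | .jumpPos m j => some { c with pc := if 0 < c.mem j then m else c.pc + 1 }
  | .read i =>
      some { c with
        pc := c.pc + 1
        mem := Function.update c.mem i (c.input.headD 0)
        input := c.input.tail }
  | .print i => some { c with pc := c.pc + 1, output := c.output ++ [c.mem i] }

/-- One step of the program `P`; no step is possible if there is no instruction to execute. -/
def step (P : Program) (c : Config) : Option Config :=
  match P[c.pc]? with
  | some I => I.exec c
  | none => none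

/-- `t` steps of the program `P`. -/
def steps (P : Program) : ℕ → Config → Option Config
  | 0, c => some c
  | t + 1, c => (step P c).bind (steps P t)

/-- The initial configuration on a given input: all memory registers contain `0`. -/
def initial (input : List ℤ) : Config := ⟨0, fun _ => 0, input, []⟩

/-- On the given input, `P` halts (by leaving the program) after at most `T` executed instructions
and has then printed exactly `1` if `A` holds, and exactly `0` otherwise. -/
def DecidesWithin (P : Program) (input : List ℤ) (T : ℕ) (A : Prop) : Prop :=
  ∃ t ≤ T, ∃ c : Config, steps P t (initial input) = some c ∧ P.length ≤ c.pc ∧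
    (A → c.output = [1]) ∧ (¬ A → c.output = [0])

end Ram

/-!
Let `X` be good, and let `Y` be its part before `out.set:1 ; !`, of length `L`. Everything depends
on two observations about the set `T` of the registers that are read at least twice in `Y`.

If `X` is correct, `T` is small (`Correct.card_le`). The executions on the zero input and on the
input with a single one in register `i` separate for good at a read instruction for `i`; call these
`n` read instructions critical. A critical instruction that reads a one leads to an instruction
which the zero input does not visit, so which is not critical, and an instruction is reached in this
way from at most two critical ones, namely a positive test just before it and a negative test two
places before it. As only `L + 1 - n` instructions of `Y ; out.set:1` are not critical, all but at
most `2 (L + 1) - 3 n` of them are reached from two critical ones. If a read instruction is, the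
instruction two places further on is not. So at most `4 (L + 1) - 6 n` read instructions are not
critical, and each register of `T` has one. If `X` exceeds the length of the shortest
non-zeroness test by `m`, this number is at most `4 m + 2`, hence at most `6 m`.

If the contents of the registers of `T` are fixed, all other contents can be treated together in
linear time, because a register outside `T` has no influence once it has been read. One backward
pass over `Y` (`table`) finds out from which positions `out.set:1` is executed whatever is in the
registers outside `T`. If the registers of `T` contain zero, the pass also counts the registers
outside `T` that are read on the way to the halt instruction when they contain zero, provided that a
one in any of them leads to `out.set:1`. By `correct_iff_table`, `X` is correct if and only if the
start is such a position for all non-zero contents of `T`, and all registers outside `T` are counted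
for the zero contents.

So the procedure determines `T`, prints 0 if `T` is too large, and otherwise makes one backward pass
for each of the at most `2 ^ (4 m + 2)` contents of `T`, which are generated by a binary counter.
It is written in a small imperative language with arrays, and its correctness and running time are
shown there (`procedure_ends`). A translation to RAM programs costs a constant factor
(`Runs.reaches`).
-/

namespace NonzeroTest

/-! ### Abstract programs -/

/-- Instructions of the body of a good instruction sequence: `read sg i` is the positive
(`sg = true`) or negative (`sg = false`) test of register `i`, and `jump l` is the forward jump
over `l` instructions, that is `#(l + 1)`. -/
inductive Op (ι : Type) : Type
  | read (sg : Bool) (i : ι)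
  | jump (l : ℕ)

/-- Backward recursion over a program: the value at the end of the program is given by `base`, and
the value at an instruction `u` is obtained by `h u` from the values at the later positions, which
are counted from the position after `u`. -/
def backward {ι β : Type} (h : Op ι → (ℕ → β) → β) (base : ℕ → β) : List (Op ι) → ℕ → β
  | [], s => base s
  | u :: Y, 0 => h u (backward h base Y)
  | _ :: Y, s + 1 => backward h base Y s

theorem backward_of_length_le {ι β : Type} (h : Op ι → (ℕ → β) → β) (base : ℕ → β)
    (Y : List (Op ι)) (p : ℕ) (hp : Y.length ≤ p) :
    backward h base Y p = base (p - Y.length) := by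
  induction Y generalizing p with
  | nil => simp [backward]
  | cons u Y ih =>
    obtain ⟨q, rfl⟩ : ∃ q, p = q + 1 := ⟨p - 1, by simp at hp; omega⟩
    simp only [List.length_cons] at hp ⊢
    rw [backward, ih q (by omega)]
    congr 1
    omega

theorem backward_of_getElem? {ι β : Type} (h : Op ι → (ℕ → β) → β) (base : ℕ → β)
    (Y : List (Op ι)) (p : ℕ) (u : Op ι) (hu : Y[p]? = some u) :
    backward h base Y p = h u (fun s => backward h base Y (p + 1 + s)) := by
  induction Y generalizing p with
  | nil => simp at hu
  | cons v Y ih =>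
    cases p with
    | zero =>
      simp only [List.getElem?_cons_zero, Option.some.injEq] at hu
      subst hu
      rw [backward]
      congr 1
      funext s
      rw [show 0 + 1 + s = s + 1 by omega, backward]
    | succ p =>
      rw [backward, ih p (by simpa using hu)]
      congr 1
      funext s
      rw [show p + 1 + 1 + s = (p + 1 + s) + 1 by omega, backward]

/-- The number of instructions skipped after execution of an instruction on input `b`. -/
def Op.skip {ι : Type} (b : ι → Bool) : Op ι → ℕ
  | .read sg i => if b i = sg then 0 else 1
  | .jump l => l

/-- The final content of the output register if execution on input `b` starts at a given position
of the program followed by `out.set:1 ; !`, and `none` if there is no termination. -/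
def result {ι : Type} (Y : List (Op ι)) (b : ι → Bool) : ℕ → Option Bool :=
  backward (fun u r => r (u.skip b))
    (fun s => if s = 0 then some true else if s = 1 then some false else none) Y

/-- The program, followed by `out.set:1 ; !`, computes the non-zeroness test. -/
def Correct {ι : Type} (Y : List (Op ι)) : Prop :=
  ∀ b : ι → Bool, ∃ r, result Y b 0 = some r ∧ (r = true ↔ ∃ i, b i = true)

/-- The number of read instructions for register `i`. -/
def readCount {ι : Type} [DecidableEq ι] (i : ι) (Y : List (Op ι)) : ℕ :=
  Y.countP (fun u => match u with
    | .read _ j => decide (j = i)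
    | .jump _ => false)

section Semantics

variable {ι : Type} {Y : List (Op ι)} {b : ι → Bool} {p : ℕ}

theorem result_eq {u : Op ι} (hu : Y[p]? = some u) :
    result Y b p = result Y b (p + 1 + u.skip b) := by
  rw [result, backward_of_getElem? _ _ _ _ _ hu]

theorem result_length : result Y b Y.length = some true := by
  rw [result, backward_of_length_le _ _ _ _ le_rfl]; simp

theorem result_length_succ : result Y b (Y.length + 1) = some false := by
  rw [result, backward_of_length_le _ _ _ _ (by omega)]; simp

theorem result_of_lt (hp : Y.length + 1 < p) : result Y b p = none := by
  rw [result, backward_of_length_le _ _ _ _ (by omega)]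
  rw [if_neg (by omega), if_neg (by omega)]

theorem exists_getElem?_of_result {r : Bool} (hr : result Y b p = some r) :
    (∃ u, Y[p]? = some u) ∨ (p = Y.length ∧ r = true) ∨ (p = Y.length + 1 ∧ r = false) := by
  rcases lt_trichotomy p Y.length with h | h | h
  · exact Or.inl ⟨_, List.getElem?_eq_getElem h⟩
  · subst h; rw [result_length] at hr; simp_all
  · by_cases h' : p = Y.length + 1
    · subst h'; rw [result_length_succ] at hr; simp_all
    · rw [result_of_lt (by omega)] at hr; simp at hr

/-- The positions in the body, or at its end, that are visited on input `b`. -/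
inductive Visits (Y : List (Op ι)) (b : ι → Bool) : ℕ → Prop
  | start : Visits Y b 0
  | next {p : ℕ} {u : Op ι} : Visits Y b p → Y[p]? = some u → Visits Y b (p + 1 + u.skip b)

theorem Visits.result_eq (h : Visits Y b p) : result Y b p = result Y b 0 := by
  induction h with
  | start => rfl
  | next _ hu ih => rw [← ih, NonzeroTest.result_eq hu]

end Semantics

theorem readCount_append {ι : Type} [DecidableEq ι] (i : ι) (Y Y' : List (Op ι)) :
    readCount i (Y ++ Y') = readCount i Y + readCount i Y' := by
  simp [readCount]

theorem readCount_pos_iff {ι : Type} [DecidableEq ι] {i : ι} {Y : List (Op ι)} :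
    0 < readCount i Y ↔ ∃ (p : ℕ) (sg : Bool), Y[p]? = some (Op.read sg i) := by
  unfold readCount
  rw [List.countP_pos_iff]
  constructor
  · rintro ⟨u, hu, h⟩
    obtain ⟨p, hp⟩ := List.mem_iff_getElem?.1 hu
    cases u with
    | read sg j => exact ⟨p, sg, by simp at h; rw [hp, h]⟩
    | jump l => simp at h
  · rintro ⟨p, sg, hp⟩
    exact ⟨_, List.mem_of_getElem? hp, by simp⟩

theorem two_le_readCount_iff {ι : Type} [DecidableEq ι] {i : ι} {Y : List (Op ι)} :
    2 ≤ readCount i Y ↔ ∃ (p q : ℕ) (sg sg' : Bool), p < q ∧ Y[p]? = some (Op.read sg i) ∧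
      Y[q]? = some (Op.read sg' i) := by
  induction Y with
  | nil => simp [readCount]
  | cons u Y ih =>
    have key : readCount i (u :: Y) = readCount i [u] + readCount i Y :=
      readCount_append i [u] Y
    constructor
    · intro h
      by_cases h2 : 2 ≤ readCount i Y
      · obtain ⟨p, q, sg, sg', hpq, hp, hq⟩ := ih.1 h2
        exact ⟨p + 1, q + 1, sg, sg', by omega, by simpa using hp, by simpa using hq⟩
      · have h1 : readCount i [u] ≤ 1 := by
          have := List.countP_le_length (l := [u]) (p := fun u => match u with
            | .read _ j => decide (j = i)
            | .jump _ => false)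
          simpa [readCount] using this
        have h3 : 0 < readCount i [u] := by omega
        have h4 : 0 < readCount i Y := by omega
        obtain ⟨q, sg', hq⟩ := readCount_pos_iff.1 h4
        obtain ⟨p, sg, hp⟩ := readCount_pos_iff.1 h3
        have hp0 : p = 0 := by
          by_contra hne
          rw [List.getElem?_eq_none (by simp; omega)] at hp
          simp at hp
        subst hp0
        exact ⟨0, q + 1, sg, sg', by omega, by simpa using hp, by simpa using hq⟩
    · rintro ⟨p, q, sg, sg', hpq, hp, hq⟩
      obtain ⟨q, rfl⟩ : ∃ q', q = q' + 1 := ⟨q - 1, by omega⟩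
      cases p with
      | zero =>
        have h3 : 0 < readCount i [u] := readCount_pos_iff.2 ⟨0, sg, by simpa using hp⟩
        have h4 : 0 < readCount i Y := readCount_pos_iff.2 ⟨q, sg', by simpa using hq⟩
        omega
      | succ p =>
        have := ih.2 ⟨p, q, sg, sg', by omega, by simpa using hp, by simpa using hq⟩
        omega

/-! ### Few registers are read twice -/

section Bound

variable {ι : Type} [DecidableEq ι] {Y : List (Op ι)}

/-- In a correct program, the execution on the input with a single one, in register `i`, leaves
the execution on the zero input for good at a read instruction for register `i`. -/
theorem Correct.exists_critical (hY : Correct Y) (i : ι) :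
    ∃ p sg, Y[p]? = some (.read sg i) ∧ Visits Y (fun _ => false) p ∧
      Visits Y (Function.update (fun _ => false) i true) p ∧
      ∀ q, p < q → Visits Y (Function.update (fun _ => false) i true) q →
        ¬ Visits Y (fun _ => false) q := by
  classical
  have r0 : result Y (fun _ => false) 0 = some false := by
    obtain ⟨r, hr, h⟩ := hY (fun _ => false)
    cases r <;> simp_all
  have r1 : result Y (Function.update (fun _ => false) i true) 0 = some true := by
    obtain ⟨r, hr, h⟩ := hY (Function.update (fun _ => false) i true)
    have : r = true := h.2 ⟨i, by simp⟩
    rw [hr, this]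
  let S : ℕ → Prop := fun p =>
    Visits Y (fun _ => false) p ∧ Visits Y (Function.update (fun _ => false) i true) p
  have hbd : ∀ p, S p → p < Y.length := by
    rintro p ⟨h0, h1⟩
    have e0 := h0.result_eq.trans r0
    have e1 := h1.result_eq.trans r1
    rcases exists_getElem?_of_result e0 with ⟨u, hu⟩ | h | h
    · exact (List.getElem?_eq_some_iff.1 hu).1
    · simp at h
    · rcases exists_getElem?_of_result e1 with ⟨u, hu⟩ | h' | h'
      · exact (List.getElem?_eq_some_iff.1 hu).1
      · omega
      · simp at h'
  have hS0 : S 0 := ⟨.start, .start⟩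
  set p := Nat.findGreatest S Y.length with hp
  have hSp : S p := Nat.findGreatest_spec (P := S) (Nat.zero_le _) hS0
  have hmax : ∀ q, p < q → ¬ S q := fun q hq hSq =>
    absurd (Nat.le_findGreatest (hbd q hSq).le hSq) (by omega)
  have hlt := hbd p hSp
  have hu := List.getElem?_eq_getElem hlt
  have hskip : ∀ u, Y[p]? = some u →
      u.skip (fun _ => false) ≠ u.skip (Function.update (fun _ => false) i true) := by
    intro u hu he
    refine hmax (p + 1 + u.skip (fun _ => false)) (by omega) ⟨.next hSp.1 hu, ?_⟩
    rw [he]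
    exact .next hSp.2 hu
  have hne := hskip _ hu
  cases hop : Y[p] with
  | jump l => rw [hop] at hne; simp [Op.skip] at hne
  | read sg j =>
    rw [hop] at hne hu
    have hij : j = i := by
      by_contra hji
      simp [Op.skip, hji] at hne
    subst hij
    exact ⟨p, sg, hu, hSp.1, hSp.2, fun q hq h1 h0 => hmax q hq ⟨h0, h1⟩⟩

/-- In a correct program with `n` registers and `L` instructions, at most `4 (L + 1) - 6 n`
registers are read more than once. Call the read instructions of `exists_critical` critical. The
instruction reached from a critical one when it reads a one is not critical, and it is reached in
this way from at most two critical ones. If it is reached from two and it is itself a read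
instruction, then the instruction two places further on is reached from at most one. So all but
few of the non-critical instructions are jumps. -/
theorem Correct.card_le [Fintype ι] (hY : Correct Y) :
    (Finset.univ.filter fun i => 2 ≤ readCount i Y).card + 6 * Fintype.card ι ≤
      4 * (Y.length + 1) := by
  classical
  choose c sg hc hc0 hc1 hcm using hY.exists_critical
  have r1 : ∀ i, result Y (Function.update (fun _ => false) i true) 0 = some true := by
    intro i
    obtain ⟨r, hr, h⟩ := hY (Function.update (fun _ => false) i true)
    have : r = true := h.2 ⟨i, by simp⟩
    rw [hr, this]
  have hcinj : Function.Injective c := by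
    intro i j hij
    have h1 := hc i
    rw [hij, hc j] at h1
    simp at h1
    exact h1.2.symm
  -- the instruction reached from the critical one when it reads a one
  let t : ι → ℕ := fun i => c i + 1 + if true = sg i then 0 else 1
  have ht1 : ∀ i, Visits Y (Function.update (fun _ => false) i true) (t i) := by
    intro i
    have := Visits.next (hc1 i) (hc i)
    simpa [Op.skip, t] using this
  have hle : ∀ i q, Visits Y (Function.update (fun _ => false) i true) q → q ≤ Y.length := by
    intro i q hq
    rcases exists_getElem?_of_result (hq.result_eq.trans (r1 i)) with ⟨u, hu⟩ | h | h
    · exact (List.getElem?_eq_some_iff.1 hu).1.le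
    · exact h.1.le
    · simp at h
  let K : Finset ℕ := Finset.univ.image c
  let W : Finset ℕ := Finset.range (Y.length + 1) \ K
  have hKcard : K.card = Fintype.card ι := by
    rw [Finset.card_image_of_injective _ hcinj, Finset.card_univ]
  have hKsub : K ⊆ Finset.range (Y.length + 1) := by
    intro q hq
    obtain ⟨i, -, rfl⟩ := Finset.mem_image.1 hq
    have := (List.getElem?_eq_some_iff.1 (hc i)).1
    simp; omega
  have hWcard : W.card + Fintype.card ι = Y.length + 1 := by
    have := Finset.card_sdiff_add_card_eq_card hKsub
    rw [hKcard, Finset.card_range] at this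
    exact this
  have hW : ∀ i q, c i < q → Visits Y (Function.update (fun _ => false) i true) q → q ∈ W := by
    intro i q hiq hq
    refine Finset.mem_sdiff.2 ⟨by have := hle i q hq; simp; omega, fun hK => ?_⟩
    obtain ⟨j, -, rfl⟩ := Finset.mem_image.1 hK
    exact hcm i _ hiq hq (hc0 j)
  have htW : ∀ i, t i ∈ W := fun i => hW i _ (by simp only [t]; omega) (ht1 i)
  let fib : ℕ → Finset ι := fun w => Finset.univ.filter fun i => t i = w
  -- positive tests immediately precede the instruction, negative ones come two places before it
  have hfib : ∀ w, (fib w).card ≤ 2 := by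
    intro w
    by_contra! h3
    obtain ⟨i, hi, j, hj, hij, hs⟩ : ∃ i ∈ fib w, ∃ j ∈ fib w, i ≠ j ∧ sg i = sg j :=
      Finset.exists_ne_map_eq_of_card_lt_of_maps_to (s := fib w) (t := Finset.univ)
        (by simpa using h3) (fun _ _ => Finset.mem_univ _)
    simp only [fib, Finset.mem_filter, Finset.mem_univ, true_and, t] at hi hj
    rw [hs] at hi
    exact hij (hcinj (by omega))
  let S : Finset ℕ := W.filter fun w => (fib w).card ≤ 1
  have hScard : S.card + 3 * Fintype.card ι ≤ 2 * (Y.length + 1) := by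
    have h1 : Fintype.card ι = ∑ w ∈ W, (fib w).card := by
      rw [← Finset.card_univ]
      exact Finset.card_eq_sum_card_fiberwise fun i _ => htW i
    have h2 : ∑ w ∈ W, ((fib w).card + if (fib w).card ≤ 1 then 1 else 0) ≤ ∑ w ∈ W, 2 := by
      refine Finset.sum_le_sum fun w _ => ?_
      have := hfib w
      split_ifs <;> omega
    rw [Finset.sum_add_distrib, ← h1, ← Finset.card_filter, Finset.sum_const, smul_eq_mul] at h2
    have h3 : S.card = (W.filter fun w => (fib w).card ≤ 1).card := rfl
    omega
  -- non-critical read instructions that are reached from two critical ones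
  let R : Finset ℕ := W.filter fun w => ¬ (fib w).card ≤ 1 ∧ ∃ s j, Y[w]? = some (.read s j)
  have hR : ∀ w ∈ R, w + 2 ∈ S := by
    intro w hw
    obtain ⟨hwW, hw2, s, j, hwj⟩ := Finset.mem_filter.1 hw
    obtain ⟨i, hi, i', hi', hii'⟩ := Finset.one_lt_card.1 (not_le.1 hw2)
    simp only [fib, Finset.mem_filter, Finset.mem_univ, true_and] at hi hi'
    -- one of the two critical instructions is a positive test
    obtain ⟨i, hi, hsi⟩ : ∃ i, t i = w ∧ sg i = true := by
      by_contra! hno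
      have e1 := hno i hi
      have e2 := hno i' hi'
      simp only [t] at hi hi'
      simp only [ne_eq, Bool.not_eq_true] at e1 e2
      rw [e1] at hi
      rw [e2] at hi'
      exact hii' (hcinj (by omega))
    have hciw : c i + 1 = w := by simpa [t, hsi] using hi
    have hz : Visits Y (fun _ => false) (w + 1) := by
      have := Visits.next (hc0 i) (hc i)
      simpa [Op.skip, hsi, hciw] using this
    have hv := hi ▸ ht1 i
    have hnext : Visits Y (Function.update (fun _ => false) i true) (w + 2) := by
      have := Visits.next hv hwj
      by_cases hs : Function.update (fun _ => false) i true j = s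
      · simp only [Op.skip, hs, if_true, add_zero] at this
        exact absurd hz (hcm i _ (by omega) this)
      · simpa [Op.skip, hs] using this
    refine Finset.mem_filter.2 ⟨hW i _ (by omega) hnext, Finset.card_le_one.2 ?_⟩
    intro a ha a' ha'
    simp only [fib, Finset.mem_filter, Finset.mem_univ, true_and] at ha ha'
    have hcrit : ∀ a, c a ≠ w := fun a h =>
      (Finset.mem_sdiff.1 hwW).2 (Finset.mem_image.2 ⟨a, Finset.mem_univ _, h⟩)
    have hpos : ∀ a, t a = w + 2 → c a = w + 1 := by
      intro a ha
      have := hcrit a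
      simp only [t] at ha
      split_ifs at ha <;> omega
    exact hcinj ((hpos a ha).trans (hpos a' ha').symm)
  have hRcard : R.card ≤ S.card :=
    Finset.card_le_card_of_injOn (fun w => w + 2) hR (fun a _ b _ h => by simpa using h)
  have hT : (Finset.univ.filter fun i => 2 ≤ readCount i Y).card ≤ (R ∪ S).card := by
    have hex : ∀ i, 2 ≤ readCount i Y → ∃ w s, w ∈ R ∪ S ∧ Y[w]? = some (.read s i) := by
      intro i hi
      obtain ⟨p, q, s, s', hpq, hp, hq⟩ := two_le_readCount_iff.1 hi
      obtain ⟨w, s, hw, hne⟩ : ∃ w s, Y[w]? = some (.read s i) ∧ w ≠ c i := by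
        by_cases h : p = c i
        · exact ⟨q, s', hq, by omega⟩
        · exact ⟨p, s, hp, h⟩
      have hwW : w ∈ W := by
        refine Finset.mem_sdiff.2 ⟨by
          have := (List.getElem?_eq_some_iff.1 hw).1
          simp; omega, fun hK => ?_⟩
        obtain ⟨j, -, rfl⟩ := Finset.mem_image.1 hK
        rw [hc j] at hw
        simp at hw
        exact hne (by rw [hw.2])
      refine ⟨w, s, ?_, hw⟩
      by_cases h1 : (fib w).card ≤ 1
      · exact Finset.mem_union_right _ (Finset.mem_filter.2 ⟨hwW, h1⟩)
      · exact Finset.mem_union_left _ (Finset.mem_filter.2 ⟨hwW, h1, s, i, hw⟩)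
    choose! w s hw hw' using hex
    refine Finset.card_le_card_of_injOn w (fun i hi => hw i (by simpa using hi)) ?_
    intro i hi j hj hij
    simp only [Finset.coe_filter, Finset.mem_univ, true_and, Set.mem_ofPred_eq] at hi hj
    have h1 := hw' i hi
    rw [hij, hw' j hj] at h1
    simp at h1
    exact h1.2.symm
  have := Finset.card_union_le R S
  omega

end Bound

/-! ### The correctness criterion -/

theorem result_read {ι : Type} {Y : List (Op ι)} {p : ℕ} {sg : Bool} {i : ι}
    (hu : Y[p]? = some (.read sg i)) (b : ι → Bool) :
    result Y b p = result Y b (p + 1 + if b i = sg then 0 else 1) :=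
  result_eq hu

/-- Downward induction on the position in a program. -/
theorem position_induction {ι : Type} (Y : List (Op ι)) {M : ℕ → Prop}
    (last : ∀ p, Y.length ≤ p → M p)
    (body : ∀ p u, Y[p]? = some u → (∀ q, p < q → M q) → M p) (p : ℕ) : M p := by
  induction h : Y.length - p using Nat.strong_induction_on generalizing p with
  | _ d ih =>
    rcases Nat.lt_or_ge p Y.length with hp | hp
    · refine body p _ (List.getElem?_eq_getElem hp) fun q hq => ?_
      exact ih (Y.length - q) (by omega) q rfl
    · exact last p hp

/-- The result depends only on the registers that are read later. -/
theorem result_congr {ι : Type} {Y : List (Op ι)} (b b' : ι → Bool) (p : ℕ)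
    (h : ∀ q i sg, p ≤ q → Y[q]? = some (.read sg i) → b i = b' i) :
    result Y b p = result Y b' p := by
  induction p using position_induction Y with
  | last p hp => rw [result, result, backward_of_length_le _ _ _ _ hp,
      backward_of_length_le _ _ _ _ hp]
  | body p u hu ih =>
    have hs : u.skip b = u.skip b' := by
      cases u with
      | jump l => rfl
      | read sg i => simp only [Op.skip, h p i sg le_rfl hu]
    rw [result_eq hu, result_eq hu, hs]
    exact ih _ (by omega) fun q i sg hq hr => h q i sg (by omega) hr

section Criterion

variable {ι : Type} [DecidableEq ι] {T : Finset ι} {Y : List (Op ι)}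

/-- For a set `T` of registers with contents `a`, the backward recursion that computes a pair.
If the registers outside `T` are read at most once, the first component at a position says whether
execution from there sets the output register for all contents of the registers outside `T`. If the
registers of `T` contain zero, the second component is positive if execution from there computes
the non-zeroness test of those registers outside `T` that are read on the way to the halt
instruction when they contain zero; it is then one more than the number of these registers. -/
def table (T : Finset ι) (a : ι → Bool) (Y : List (Op ι)) : ℕ → Bool × ℕ :=
  backward (fun u r => match u with
    | .jump l => r l
    | .read sg i =>
        let t := r (if true = sg then 0 else 1)
        let f := r (if false = sg then 0 else 1)
        if i ∈ T then (if a i then t.1 else f.1, f.2)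
        else (t.1 && f.1, if t.1 = true ∧ 0 < f.2 then f.2 + 1 else 0))
    (fun s => (decide (s = 0), if s = 1 then 1 else 0)) Y

theorem table_of_length_le (a : ι → Bool) {p : ℕ} (hp : Y.length ≤ p) :
    table T a Y p = (decide (p = Y.length), if p = Y.length + 1 then 1 else 0) := by
  rw [table, backward_of_length_le _ _ _ _ hp]
  have h1 : p - Y.length = 0 ↔ p = Y.length := by omega
  have h2 : p - Y.length = 1 ↔ p = Y.length + 1 := by omega
  simp only [h1, h2]

theorem table_jump (a : ι → Bool) {p l : ℕ} (hu : Y[p]? = some (.jump l)) :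
    table T a Y p = table T a Y (p + 1 + l) := by
  rw [table, backward_of_getElem? _ _ _ _ _ hu]

theorem table_read_mem (a : ι → Bool) {p : ℕ} {sg : Bool} {i : ι}
    (hu : Y[p]? = some (.read sg i)) (hi : i ∈ T) :
    table T a Y p =
      (if a i then (table T a Y (p + 1 + if true = sg then 0 else 1)).1
        else (table T a Y (p + 1 + if false = sg then 0 else 1)).1,
        (table T a Y (p + 1 + if false = sg then 0 else 1)).2) := by
  conv_lhs => rw [table, backward_of_getElem? _ _ _ _ _ hu]
  simp only [if_pos hi]
  rfl

theorem table_read_notMem (a : ι → Bool) {p : ℕ} {sg : Bool} {i : ι}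
    (hu : Y[p]? = some (.read sg i)) (hi : i ∉ T) :
    table T a Y p =
      ((table T a Y (p + 1 + if true = sg then 0 else 1)).1 &&
        (table T a Y (p + 1 + if false = sg then 0 else 1)).1,
        if (table T a Y (p + 1 + if true = sg then 0 else 1)).1 = true ∧
          0 < (table T a Y (p + 1 + if false = sg then 0 else 1)).2 then
          (table T a Y (p + 1 + if false = sg then 0 else 1)).2 + 1 else 0) := by
  conv_lhs => rw [table, backward_of_getElem? _ _ _ _ _ hu]
  simp only [if_neg hi]
  rfl

/-- A register that is read only once has no influence after it has been read. -/
theorem result_update_of_lt {p q : ℕ} {sg : Bool} {i : ι} (hi : readCount i Y ≤ 1)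
    (hu : Y[p]? = some (.read sg i)) (hpq : p < q) (b : ι → Bool) (c : Bool) :
    result Y (Function.update b i c) q = result Y b q := by
  refine result_congr _ _ _ fun r j sg' hr hj => ?_
  rw [Function.update_of_ne]
  rintro rfl
  have := two_le_readCount_iff.2 ⟨p, r, sg, sg', by omega, hu, hj⟩
  omega

/-- Both contents of a register outside `T` have to be considered when it is read, and neither of
them restricts the later execution. -/
theorem table_fst_iff (hT : ∀ i ∉ T, readCount i Y ≤ 1) (a : ι → Bool) (p : ℕ) :
    (table T a Y p).1 = true ↔
      ∀ b : ι → Bool, (∀ i ∈ T, b i = a i) → result Y b p = some true := by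
  induction p using position_induction Y with
  | last p hp =>
    rw [table_of_length_le _ hp]
    simp only [decide_eq_true_eq]
    constructor
    · rintro rfl b -
      exact result_length
    · intro h
      rcases exists_getElem?_of_result (h a fun _ _ => rfl) with ⟨u, hu⟩ | h | h
      · have := (List.getElem?_eq_some_iff.1 hu).1; omega
      · exact h.1
      · simp at h
  | body p u hu ih =>
    cases u with
    | jump l =>
      rw [table_jump _ hu, ih _ (by omega)]
      exact forall₂_congr fun b _ => by rw [result_eq hu]; rfl
    | read sg i =>
      by_cases hi : i ∈ T
      · rw [table_read_mem _ hu hi]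
        have key : (if a i = true then (table T a Y (p + 1 + if true = sg then 0 else 1)).1
            else (table T a Y (p + 1 + if false = sg then 0 else 1)).1) =
            (table T a Y (p + 1 + if a i = sg then 0 else 1)).1 := by
          cases a i <;> simp
        simp only [key]
        rw [ih _ (by omega)]
        exact forall₂_congr fun b hb => by rw [result_read hu, hb i hi]
      · rw [table_read_notMem _ hu hi, Bool.and_eq_true, ih _ (by omega), ih _ (by omega)]
        constructor
        · rintro ⟨h1, h0⟩ b hb
          rw [result_read hu]
          cases b i
          · exact h0 b hb
          · exact h1 b hb
        · intro h
          have key : ∀ c b, (∀ i ∈ T, b i = a i) →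
              result Y b (p + 1 + if c = sg then 0 else 1) = some true := by
            intro c b hb
            have := h (Function.update b i c) fun j hj => by
              rw [Function.update_of_ne (by rintro rfl; exact hi hj), hb j hj]
            rw [result_read hu, Function.update_self,
              result_update_of_lt (hT i hi) hu (by omega)] at this
            exact this
          exact ⟨key true, key false⟩

/-- Execution from position `p`, with zero in the registers of `T`, computes the non-zeroness test
of the registers in `B`. -/
def TestsFrom (T : Finset ι) (Y : List (Op ι)) (B : Finset ι) (p : ℕ) : Prop :=
  ∀ b : ι → Bool, (∀ i ∈ T, b i = false) →
    ∃ r, result Y b p = some r ∧ (r = true ↔ ∃ i ∈ B, b i = true)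

/-- A positive second component of `table` is one more than the number of registers that are tested
by execution from there. -/
theorem exists_testsFrom (hT : ∀ i ∉ T, readCount i Y ≤ 1) (p c : ℕ)
    (hc : (table T (fun _ => false) Y p).2 = c + 1) :
    ∃ B : Finset ι, Disjoint B T ∧ B.card = c ∧ TestsFrom T Y B p := by
  induction p using position_induction Y generalizing c with
  | last p hp =>
    rw [table_of_length_le _ hp] at hc
    split_ifs at hc with h
    obtain rfl : c = 0 := by simpa using hc.symm
    refine ⟨∅, by simp, rfl, fun b _ => ⟨false, ?_, by simp⟩⟩
    rw [h, result_length_succ]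
  | body p u hu ih =>
    cases u with
    | jump l =>
      rw [table_jump _ hu] at hc
      obtain ⟨B, hB, hBc, h⟩ := ih _ (by omega) c hc
      refine ⟨B, hB, hBc, fun b hb => ?_⟩
      rw [result_eq hu]
      exact h b hb
    | read sg i =>
      by_cases hi : i ∈ T
      · rw [table_read_mem _ hu hi] at hc
        obtain ⟨B, hB, hBc, h⟩ := ih _ (by omega) c hc
        refine ⟨B, hB, hBc, fun b hb => ?_⟩
        rw [result_read hu, hb i hi]
        exact h b hb
      · rw [table_read_notMem _ hu hi] at hc
        simp only at hc
        obtain ⟨h1, h0⟩ := (ite_ne_right_iff.1 (hc.trans_ne (Nat.succ_ne_zero c))).1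
        rw [if_pos ⟨h1, h0⟩] at hc
        obtain ⟨c, rfl⟩ : ∃ c', c = c' + 1 := ⟨c - 1, by omega⟩
        obtain ⟨B, hB, hBc, h⟩ :=
          ih (p + 1 + if false = sg then 0 else 1) (by omega) c (by omega)
        rw [table_fst_iff hT] at h1
        have hiB : i ∉ B := by
          intro hiB
          obtain ⟨r, hr, hr'⟩ := h (Function.update (fun _ => false) i true) fun j hj => by
            rw [Function.update_of_ne (by rintro rfl; exact hi hj)]
          rw [result_update_of_lt (hT i hi) hu (by omega)] at hr
          obtain ⟨r', hr2, hr2'⟩ := h (fun _ => false) fun _ _ => rfl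
          have e1 : r = true := hr'.2 ⟨i, hiB, by simp⟩
          have e2 : r' = false := by simpa using hr2'
          rw [hr2, e1, e2] at hr
          simp at hr
        refine ⟨insert i B, Finset.disjoint_insert_left.2 ⟨hi, hB⟩, by
          rw [Finset.card_insert_of_notMem hiB, hBc], fun b hb => ?_⟩
        rw [result_read hu]
        cases hbi : b i
        · obtain ⟨r, hr, hr'⟩ := h b hb
          exact ⟨r, hr, by rw [hr']; simp [hbi]⟩
        · exact ⟨true, h1 b hb, by simp [hbi]⟩

/-- Converse of `exists_testsFrom`. All registers outside `T` that are read later have to be in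
`B`, since the second component is zero if a one in such a register makes no difference. -/
theorem TestsFrom.table_snd (hT : ∀ i ∉ T, readCount i Y ≤ 1) {B : Finset ι} {p : ℕ}
    (hBT : Disjoint B T)
    (hB : ∀ i ∉ T, ∀ q sg, p ≤ q → Y[q]? = some (.read sg i) → i ∈ B)
    (h : TestsFrom T Y B p) : (table T (fun _ => false) Y p).2 = B.card + 1 := by
  induction p using position_induction Y generalizing B with
  | last p hp =>
    rw [table_of_length_le _ hp]
    obtain ⟨r, hr, hr'⟩ := h (fun _ => false) fun _ _ => rfl
    have e : r = false := by simpa using hr'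
    subst e
    rcases exists_getElem?_of_result hr with ⟨u, hu⟩ | h' | h'
    · have := (List.getElem?_eq_some_iff.1 hu).1; omega
    · simp at h'
    · rw [if_pos h'.1]
      rcases B.eq_empty_or_nonempty with rfl | ⟨i, hi⟩
      · rfl
      · obtain ⟨r, hr, hr'⟩ := h (Function.update (fun _ => false) i true) fun j hj => by
          rw [Function.update_of_ne]
          rintro rfl
          exact Finset.disjoint_left.1 hBT hi hj
        have : r = true := hr'.2 ⟨i, hi, by simp⟩
        rw [h'.1, result_length_succ, this] at hr
        simp at hr
  | body p u hu ih =>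
    cases u with
    | jump l =>
      rw [table_jump _ hu]
      refine ih _ (by omega) hBT (fun i hi q sg hq => hB i hi q sg (by omega)) fun b hb => ?_
      have := h b hb
      rw [result_eq hu] at this
      exact this
    | read sg i =>
      by_cases hi : i ∈ T
      · rw [table_read_mem _ hu hi]
        refine ih _ (by omega) hBT (fun i hi q sg hq => hB i hi q sg (by omega)) fun b hb => ?_
        have := h b hb
        rw [result_read hu, hb i hi] at this
        exact this
      · have hiB : i ∈ B := hB i hi p sg le_rfl hu
        have hup : ∀ (b : ι → Bool) (c : Bool), (∀ j ∈ T, b j = false) →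
            ∀ j ∈ T, Function.update b i c j = false := by
          intro b c hb j hj
          rw [Function.update_of_ne (by rintro rfl; exact hi hj), hb j hj]
        have h1 : (table T (fun _ => false) Y (p + 1 + if true = sg then 0 else 1)).1 = true := by
          rw [table_fst_iff hT]
          intro b hb
          obtain ⟨r, hr, hr'⟩ := h _ (hup b true hb)
          have : r = true := hr'.2 ⟨i, hiB, by simp⟩
          rw [result_read hu, Function.update_self,
            result_update_of_lt (hT i hi) hu (by omega), this] at hr
          exact hr
        have h0 : (table T (fun _ => false) Y (p + 1 + if false = sg then 0 else 1)).2 =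
            (B.erase i).card + 1 := by
          refine ih _ (by omega) (hBT.mono_left (Finset.erase_subset _ _)) ?_ ?_
          · intro j hj q sg' hq hr
            refine Finset.mem_erase.2 ⟨?_, hB j hj q sg' (by omega) hr⟩
            rintro rfl
            have := two_le_readCount_iff.2 ⟨p, q, sg, sg', by omega, hu, hr⟩
            have := hT j hi
            omega
          · intro b hb
            obtain ⟨r, hr, hr'⟩ := h _ (hup b false hb)
            rw [result_read hu, Function.update_self,
              result_update_of_lt (hT i hi) hu (by omega)] at hr
            refine ⟨r, hr, hr'.trans ⟨?_, ?_⟩⟩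
            · rintro ⟨j, hj, hbj⟩
              have hji : j ≠ i := by rintro rfl; simp at hbj
              rw [Function.update_of_ne hji] at hbj
              exact ⟨j, Finset.mem_erase.2 ⟨hji, hj⟩, hbj⟩
            · rintro ⟨j, hj, hbj⟩
              obtain ⟨hji, hj⟩ := Finset.mem_erase.1 hj
              exact ⟨j, hj, by rw [Function.update_of_ne hji, hbj]⟩
        rw [table_read_notMem _ hu hi]
        simp only [h1, h0, true_and]
        rw [if_pos (by omega), Finset.card_erase_add_one hiB]

/-- Only the contents of the registers that are read more than once have to be tried. -/
theorem correct_iff_table [Fintype ι] (hT : ∀ i ∉ T, readCount i Y ≤ 1) :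
    Correct Y ↔ Fintype.card ι < (table T (fun _ => false) Y 0).2 + T.card ∧
      ∀ a : ι → Bool, (∃ i ∈ T, a i = true) → (table T a Y 0).1 = true := by
  have hcard : Tᶜ.card + T.card = Fintype.card ι := by
    rw [add_comm]; exact Finset.card_add_card_compl T
  constructor
  · intro h
    constructor
    · have : TestsFrom T Y Tᶜ 0 := by
        intro b hb
        obtain ⟨r, hr, hr'⟩ := h b
        refine ⟨r, hr, hr'.trans (exists_congr fun i => ?_)⟩
        simp only [Finset.mem_compl, iff_and_self]
        intro hbi hiT
        simp [hb i hiT] at hbi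
      rw [this.table_snd hT (Finset.disjoint_left.2 fun i hi => Finset.mem_compl.1 hi)
        (fun i hi _ _ _ _ => Finset.mem_compl.2 hi)]
      omega
    · rintro a ⟨i, hi, hai⟩
      rw [table_fst_iff hT]
      intro b hb
      obtain ⟨r, hr, hr'⟩ := h b
      rw [hr, hr'.2 ⟨i, (hb i hi).trans hai⟩]
  · rintro ⟨h0, h1⟩ b
    by_cases hb : ∃ i ∈ T, b i = true
    · have := (table_fst_iff hT b 0).1 (h1 b hb) b fun _ _ => rfl
      obtain ⟨i, _, hi⟩ := hb
      exact ⟨true, this, by simpa using ⟨i, hi⟩⟩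
    · have hb' : ∀ i ∈ T, b i = false := by simpa using hb
      have hTn : T.card ≤ Fintype.card ι := Finset.card_le_univ _
      obtain ⟨c, hc⟩ : ∃ c, (table T (fun _ => false) Y 0).2 = c + 1 :=
        ⟨(table T (fun _ => false) Y 0).2 - 1, by omega⟩
      obtain ⟨B, hBT, hBc, hB⟩ := exists_testsFrom hT 0 c hc
      have hBeq : B = Tᶜ := by
        refine Finset.eq_of_subset_of_card_le ?_ (by omega)
        intro i hi
        exact Finset.mem_compl.2 (Finset.disjoint_left.1 hBT hi)
      obtain ⟨r, hr, hr'⟩ := hB b hb'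
      refine ⟨r, hr, hr'.trans ⟨fun ⟨i, _, hi⟩ => ⟨i, hi⟩, fun ⟨i, hi⟩ => ⟨i, ?_, hi⟩⟩⟩
      rw [hBeq, Finset.mem_compl]
      intro hiT
      simp [hb' i hiT] at hi

end Criterion

/-! ### A small imperative language -/

/-- Expressions over integer variables. -/
inductive Exp (V : Type) : Type
  | const (c : ℤ)
  | var (x : V)
  | add (e f : Exp V)
  | sub (e f : Exp V)

/-- The value of an expression. -/
def Exp.eval {V : Type} (v : V → ℤ) : Exp V → ℤ
  | .const c => c
  | .var x => v x
  | .add e f => e.eval v + f.eval v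
  | .sub e f => e.eval v - f.eval v

/-- Commands over integer variables `V` and infinite integer arrays `A`. Conditions hold if the
value of the expression is positive. -/
inductive Cmd (V A : Type) : Type
  | skip
  | assign (x : V) (e : Exp V)
  | load (x : V) (k : A) (e : Exp V)
  | store (k : A) (e f : Exp V)
  | read (x : V)
  | print (e : Exp V)
  | seq (c d : Cmd V A)
  | ite (e : Exp V) (c d : Cmd V A)
  | loop (e : Exp V) (c : Cmd V A)

/-- States: contents of variables and arrays, remaining input, output so far. -/
structure State (V A : Type) : Type where
  var : V → ℤ
  arr : A → ℕ → ℤ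
  inp : List ℤ
  out : List ℤ

/-- Assignment to a variable. -/
def State.setVar {V A : Type} [DecidableEq V] (s : State V A) (x : V) (z : ℤ) : State V A :=
  { s with var := Function.update s.var x z }

/-- Assignment to an array entry. -/
def State.setArr {V A : Type} [DecidableEq A] (s : State V A) (k : A) (i : ℕ) (z : ℤ) :
    State V A :=
  { s with arr := Function.update s.arr k (Function.update (s.arr k) i z) }

section Language

variable {V A : Type} [DecidableEq V] [DecidableEq A]

/-- `Runs c s t s'`: the command `c`, started in state `s`, terminates in state `s'`, where `t` is
the number of basic commands executed and conditions evaluated. Array indices must not be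
negative. -/
inductive Runs : Cmd V A → State V A → ℕ → State V A → Prop
  | skip (s) : Runs .skip s 0 s
  | assign (s x e) : Runs (.assign x e) s 1 (s.setVar x (e.eval s.var))
  | load (s x k) (e : Exp V) (h : 0 ≤ e.eval s.var) :
      Runs (.load x k e) s 1 (s.setVar x (s.arr k (e.eval s.var).toNat))
  | store (s k) (e f : Exp V) (h : 0 ≤ e.eval s.var) :
      Runs (.store k e f) s 1 (s.setArr k (e.eval s.var).toNat (f.eval s.var))
  | read (s x) :
      Runs (.read x) s 1 { s.setVar x (s.inp.headD 0) with inp := s.inp.tail }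
  | print (s e) : Runs (.print e) s 1 { s with out := s.out ++ [e.eval s.var] }
  | seq {c d s s' s'' t t'} : Runs c s t s' → Runs d s' t' s'' → Runs (.seq c d) s (t + t') s''
  | ite_pos {e c d s t s'} : 0 < e.eval s.var → Runs c s t s' → Runs (.ite e c d) s (1 + t) s'
  | ite_neg {e c d s t s'} : ¬ 0 < e.eval s.var → Runs d s t s' → Runs (.ite e c d) s (1 + t) s'
  | loop_pos {e c s t s' t' s''} : 0 < e.eval s.var → Runs c s t s' →
      Runs (.loop e c) s' t' s'' → Runs (.loop e c) s (1 + (t + t')) s''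
  | loop_neg {e c s} : ¬ 0 < e.eval s.var → Runs (.loop e c) s 1 s

/-- Started in state `s`, the command `c` terminates within time `T` in a state with property
`Q`. -/
def Ends (c : Cmd V A) (s : State V A) (T : ℕ) (Q : State V A → Prop) : Prop :=
  ∃ t ≤ T, ∃ s', Runs c s t s' ∧ Q s'

theorem Ends.seq {c d : Cmd V A} {s : State V A} {T T' T'' : ℕ} {Q R : State V A → Prop}
    (h : Ends c s T R) (h' : ∀ s', R s' → Ends d s' T' Q) (hT : T + T' ≤ T'') :
    Ends (.seq c d) s T'' Q := by
  obtain ⟨t, ht, s', hr, hR⟩ := h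
  obtain ⟨t', ht', s'', hr', hQ⟩ := h' s' hR
  exact ⟨t + t', by omega, s'', .seq hr hr', hQ⟩

theorem Ends.mono {c : Cmd V A} {s : State V A} {T T' : ℕ} {Q R : State V A → Prop}
    (h : Ends c s T R) (hT : T ≤ T') (hQ : ∀ s', R s' → Q s') : Ends c s T' Q := by
  obtain ⟨t, ht, s', hr, hR⟩ := h
  exact ⟨t, ht.trans hT, s', hr, hQ s' hR⟩

theorem Ends.loop_pos {e : Exp V} {c : Cmd V A} {s : State V A} {T T' T'' : ℕ}
    {Q R : State V A → Prop} (he : 0 < e.eval s.var) (h : Ends c s T R)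
    (h' : ∀ s', R s' → Ends (.loop e c) s' T' Q) (hT : 1 + (T + T') ≤ T'') :
    Ends (.loop e c) s T'' Q := by
  obtain ⟨t, ht, s', hr, hR⟩ := h
  obtain ⟨t', ht', s'', hr', hQ⟩ := h' s' hR
  exact ⟨1 + (t + t'), by omega, s'', .loop_pos he hr hr', hQ⟩

theorem Ends.loop_neg {e : Exp V} {c : Cmd V A} {s : State V A} {T : ℕ}
    {Q : State V A → Prop} (he : ¬ 0 < e.eval s.var) (hT : 1 ≤ T) (h : Q s) :
    Ends (.loop e c) s T Q :=
  ⟨1, hT, s, .loop_neg he, h⟩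

/-- A loop with an invariant `I` that is indexed by the number of remaining rounds. -/
theorem Ends.loop_of_invariant {e : Exp V} {c : Cmd V A} {T : ℕ} (I : ℕ → State V A → Prop)
    (hpos : ∀ r s, I (r + 1) s → 0 < e.eval s.var ∧ Ends c s T (I r))
    (hzero : ∀ s, I 0 s → ¬ 0 < e.eval s.var) {r : ℕ} {s : State V A} (hs : I r s) :
    Ends (.loop e c) s (r * (T + 1) + 1) (I 0) := by
  induction r generalizing s with
  | zero => exact .loop_neg (hzero s hs) (by omega) hs
  | succ r ih =>
    obtain ⟨he, hc⟩ := hpos r s hs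
    exact .loop_pos he hc (fun s' hs' => ih hs') (by rw [Nat.succ_mul]; omega)

/-- The weakest precondition of a command without loops. -/
def wp : Cmd V A → (State V A → Prop) → State V A → Prop
  | .skip, Q, s => Q s
  | .assign x e, Q, s => Q (s.setVar x (e.eval s.var))
  | .load x k e, Q, s =>
      0 ≤ e.eval s.var ∧ Q (s.setVar x (s.arr k (e.eval s.var).toNat))
  | .store k e f, Q, s =>
      0 ≤ e.eval s.var ∧ Q (s.setArr k (e.eval s.var).toNat (f.eval s.var))
  | .read x, Q, s => Q { s.setVar x (s.inp.headD 0) with inp := s.inp.tail }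
  | .print e, Q, s => Q { s with out := s.out ++ [e.eval s.var] }
  | .seq c d, Q, s => wp c (wp d Q) s
  | .ite e c d, Q, s => (0 < e.eval s.var → wp c Q s) ∧ (¬ 0 < e.eval s.var → wp d Q s)
  | .loop _ _, _, _ => False

/-- An upper bound for the running time of a command without loops. -/
def Cmd.size : Cmd V A → ℕ
  | .seq c d => c.size + d.size
  | .ite _ c d => c.size + d.size + 1
  | .loop _ c => c.size + 1
  | _ => 1

theorem Ends.of_wp {c : Cmd V A} {Q : State V A → Prop} {s : State V A} (h : wp c Q s) :
    Ends c s c.size Q := by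
  induction c generalizing s Q with
  | skip => exact ⟨0, Nat.zero_le _, s, .skip s, h⟩
  | assign x e => exact ⟨1, le_rfl, _, .assign s x e, h⟩
  | load x k e => exact ⟨1, le_rfl, _, .load s x k e h.1, h.2⟩
  | store k e f => exact ⟨1, le_rfl, _, .store s k e f h.1, h.2⟩
  | read x => exact ⟨1, le_rfl, _, .read s x, h⟩
  | print e => exact ⟨1, le_rfl, _, .print s e, h⟩
  | seq c d ihc ihd => exact (ihc h).seq (fun s' hs' => ihd hs') le_rfl
  | ite e c d ihc ihd =>
    by_cases he : 0 < e.eval s.var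
    · obtain ⟨t, ht, s', hr, hQ⟩ := ihc (h.1 he)
      exact ⟨1 + t, by simp only [Cmd.size]; omega, s', .ite_pos he hr, hQ⟩
    · obtain ⟨t, ht, s', hr, hQ⟩ := ihd (h.2 he)
      exact ⟨1 + t, by simp only [Cmd.size]; omega, s', .ite_neg he hr, hQ⟩
  | loop e c => exact h.elim

end Language

/-! ### Translation to RAM programs -/

/-- An assignment of numbers to variables and arrays. Memory is divided into residue classes
modulo 8: `8 d` holds the intermediate result number `d`, `8 j + 1` the variable number `j` and
`8 i + 2 + k` the entry `i` of the array number `k`. -/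
structure Layout (V A : Type) : Type where
  var : V → ℕ
  arr : A → ℕ
  var_inj : Function.Injective var
  arr_inj : Function.Injective arr
  arr_lt : ∀ k, arr k < 6

section Compiler

open Ram (Instr Config Program)

/-- Instructions other than jumps. -/
def IsStraight : Instr → Prop
  | .jumpPos _ _ => False
  | _ => True

/-- Consecutive execution of instructions. -/
def execAll : List Instr → Config → Option Config
  | [], c => some c
  | I :: l, c => (I.exec c).bind (execAll l)

theorem execAll_append (l l' : List Instr) (c : Config) :
    execAll (l ++ l') c = (execAll l c).bind (execAll l') := by
  induction l generalizing c with
  | nil => rfl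
  | cons I l ih =>
    simp only [List.cons_append, execAll]
    cases I.exec c with
    | none => rfl
    | some c' => exact ih c'

/-- The code `l` is the part of the program `P` that begins at `o`. -/
def CodeAt (P : Program) (o : ℕ) (l : List Instr) : Prop :=
  ∃ l₁ l₂, P = l₁ ++ l ++ l₂ ∧ l₁.length = o

theorem CodeAt.left {P : Program} {o : ℕ} {l l' : List Instr} (h : CodeAt P o (l ++ l')) :
    CodeAt P o l := by
  obtain ⟨l₁, l₂, rfl, rfl⟩ := h
  exact ⟨l₁, l' ++ l₂, by simp, rfl⟩

theorem CodeAt.right {P : Program} {o : ℕ} {l l' : List Instr} (h : CodeAt P o (l ++ l')) :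
    CodeAt P (o + l.length) l' := by
  obtain ⟨l₁, l₂, rfl, rfl⟩ := h
  exact ⟨l₁ ++ l, l₂, by simp, by simp⟩

theorem CodeAt.tail {P : Program} {o : ℕ} {I : Instr} {l : List Instr} (h : CodeAt P o (I :: l)) :
    CodeAt P (o + 1) l :=
  CodeAt.right (l := [I]) h

theorem CodeAt.step_eq {P : Program} {o : ℕ} {I : Instr} {l : List Instr}
    (h : CodeAt P o (I :: l)) {c : Config} (hc : c.pc = o) : Ram.step P c = I.exec c := by
  obtain ⟨l₁, l₂, rfl, rfl⟩ := h
  simp [Ram.step, hc]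

theorem steps_add {P : Program} {t t' : ℕ} {c c' c'' : Config} (h : Ram.steps P t c = some c')
    (h' : Ram.steps P t' c' = some c'') : Ram.steps P (t + t') c = some c'' := by
  induction t generalizing c with
  | zero =>
    simp only [Ram.steps, Option.some.injEq] at h
    subst h
    simpa using h'
  | succ t ih =>
    rw [Nat.succ_add]
    simp only [Ram.steps] at h ⊢
    cases hs : Ram.step P c with
    | none => rw [hs] at h; simp at h
    | some d =>
      rw [hs] at h
      exact ih h

theorem IsStraight.pc_eq {I : Instr} (hI : IsStraight I) {c c' : Config}
    (h : I.exec c = some c') : c'.pc = c.pc + 1 := by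
  cases I <;> simp only [Instr.exec] at h <;> first
    | exact hI.elim
    | (split_ifs at h <;> simp only [Option.some.injEq] at h <;> rw [← h])
    | (simp only [Option.some.injEq] at h; rw [← h])

theorem CodeAt.steps_eq {P : Program} {o : ℕ} {l : List Instr} (h : CodeAt P o l)
    (hl : ∀ I ∈ l, IsStraight I) {c c' : Config} (hc : c.pc = o) (hcc' : execAll l c = some c') :
    Ram.steps P l.length c = some c' ∧ c'.pc = o + l.length := by
  induction l generalizing c o with
  | nil =>
    simp only [execAll, Option.some.injEq] at hcc'
    subst hcc'
    exact ⟨rfl, hc⟩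
  | cons I l ih =>
    simp only [execAll] at hcc'
    cases hs : I.exec c with
    | none => rw [hs] at hcc'; simp at hcc'
    | some d =>
      rw [hs] at hcc'
      have hd := (hl I (by simp)).pc_eq hs
      obtain ⟨h1, h2⟩ := ih h.tail (fun J hJ => hl J (by simp [hJ])) (by omega) hcc'
      refine ⟨?_, by simp only [List.length_cons]; omega⟩
      simp only [List.length_cons, Ram.steps, h.step_eq hc, hs]
      exact h1

variable {V A : Type} (Λ : Layout V A)

/-- The memory register of a variable. -/
def Layout.varAddr (x : V) : ℕ := 8 * Λ.var x + 1

/-- Code that evaluates an expression as intermediate result number `d`, using only intermediate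
results from number `d` on. -/
def Exp.code : Exp V → ℕ → List Instr
  | .const c, d => [.const (8 * d) c]
  | .var x, d => [.const (8 * d) 0, .add (8 * d) (8 * d) (Λ.varAddr x)]
  | .add e f, d => e.code d ++ (f.code (d + 1) ++ [.add (8 * d) (8 * d) (8 * (d + 1))])
  | .sub e f, d => e.code d ++ (f.code (d + 1) ++ [.sub (8 * d) (8 * d) (8 * (d + 1))])

/-- Code that evaluates the address of an entry of array `k` as intermediate result number 0. -/
def addrCode (k : A) (e : Exp V) : List Instr :=
  e.code Λ 0 ++ [.add 0 0 0, .add 0 0 0, .add 0 0 0, .const 8 (2 + (Λ.arr k : ℤ)), .add 0 0 8]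

/-- The code of a command that begins at `o`. -/
def Cmd.code : Cmd V A → ℕ → List Instr
  | .skip, _ => []
  | .assign x e, _ => e.code Λ 0 ++ [.const 8 0, .add (Λ.varAddr x) 0 8]
  | .load x k e, _ => addrCode Λ k e ++ [.load (Λ.varAddr x) 0]
  | .store k e f, _ => addrCode Λ k e ++ (f.code Λ 1 ++ [.store 0 8])
  | .read x, _ => [.read (Λ.varAddr x)]
  | .print e, _ => e.code Λ 0 ++ [.print 0]
  | .seq c d, o => c.code o ++ d.code (o + (c.code o).length)
  | .ite e c d, o =>
      let l := e.code Λ 0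
      let ld := d.code (o + (l.length + 1))
      let lc := c.code (o + (l.length + 1) + (ld.length + 2))
      (l ++ [.jumpPos (o + (l.length + 1) + (ld.length + 2)) 0]) ++
        ((ld ++ [.const 0 1,
          .jumpPos (o + (l.length + 1) + (ld.length + 2) + lc.length) 0]) ++ lc)
  | .loop e c, o =>
      let l := e.code Λ 0
      let lc := c.code (o + (l.length + 3))
      (l ++ [.jumpPos (o + (l.length + 3)) 0, .const 0 1,
          .jumpPos (o + (l.length + 3) + (lc.length + 2)) 0]) ++
        (lc ++ [.const 0 1, .jumpPos o 0])

/-- The configuration `c` represents the state `s`. -/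
structure Rep (s : State V A) (c : Config) : Prop where
  var : ∀ x, c.mem (8 * Λ.var x + 1) = s.var x
  arr : ∀ k i, c.mem (8 * i + 2 + Λ.arr k) = s.arr k i
  inp : c.input = s.inp
  out : c.output = s.out

variable {Λ}

theorem Rep.congr {s : State V A} {c c' : Config} (h : Rep Λ s c)
    (hm : ∀ i, i % 8 ≠ 0 → c'.mem i = c.mem i) (hi : c'.input = c.input)
    (ho : c'.output = c.output) : Rep Λ s c' where
  var x := by rw [hm _ (by omega), h.var]
  arr k i := by rw [hm _ (by have := Λ.arr_lt k; omega), h.arr]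
  inp := hi.trans h.inp
  out := ho.trans h.out

theorem Exp.isStraight_of_mem_code (e : Exp V) (d : ℕ) : ∀ I ∈ e.code Λ d, IsStraight I := by
  induction e generalizing d with
  | const c => simp [Exp.code, IsStraight]
  | var x => simp [Exp.code, IsStraight]
  | add e f ihe ihf =>
    intro I hI
    simp only [Exp.code, List.mem_append, List.mem_singleton] at hI
    rcases hI with h | h | rfl
    · exact ihe _ I h
    · exact ihf _ I h
    · trivial
  | sub e f ihe ihf =>
    intro I hI
    simp only [Exp.code, List.mem_append, List.mem_singleton] at hI
    rcases hI with h | h | rfl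
    · exact ihe _ I h
    · exact ihf _ I h
    · trivial

theorem Exp.execAll_code (e : Exp V) (d : ℕ) {s : State V A} {c : Config} (h : Rep Λ s c) :
    ∃ c', execAll (e.code Λ d) c = some c' ∧ c'.mem (8 * d) = e.eval s.var ∧
      (∀ i, (i % 8 ≠ 0 ∨ i < 8 * d) → c'.mem i = c.mem i) ∧ Rep Λ s c' := by
  suffices H : ∀ c, Rep Λ s c → ∃ c', execAll (e.code Λ d) c = some c' ∧
      c'.mem (8 * d) = e.eval s.var ∧
      (∀ i, (i % 8 ≠ 0 ∨ i < 8 * d) → c'.mem i = c.mem i) ∧ c'.input = c.input ∧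
      c'.output = c.output by
    obtain ⟨c', h1, h2, h3, h4, h5⟩ := H c h
    exact ⟨c', h1, h2, h3, h.congr (fun i hi => h3 i (.inl hi)) h4 h5⟩
  clear h c
  induction e generalizing d with
  | const z =>
    intro c _
    refine ⟨_, rfl, by simp [Exp.eval], fun i hi => ?_, rfl, rfl⟩
    exact Function.update_of_ne (by omega) _ _
  | var x =>
    intro c hc
    refine ⟨_, rfl, ?_, fun i hi => ?_, rfl, rfl⟩
    · simp only [Exp.eval, Function.update_self, Layout.varAddr]
      rw [Function.update_of_ne (by omega), hc.var, zero_add]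
    · simp only
      rw [Function.update_of_ne (by omega), Function.update_of_ne (by omega)]
  | add e f ihe ihf =>
    intro c hc
    obtain ⟨c₁, h1, h2, h3, h4, h5⟩ := ihe d c hc
    have hc₁ : Rep Λ s c₁ := hc.congr (fun i hi => h3 i (.inl hi)) h4 h5
    obtain ⟨c₂, g1, g2, g3, g4, g5⟩ := ihf (d + 1) c₁ hc₁
    refine ⟨{ c₂ with
      pc := c₂.pc + 1
      mem := Function.update c₂.mem (8 * d) (c₂.mem (8 * d) + c₂.mem (8 * (d + 1))) },
      ?_, ?_, fun i hi => ?_, g4.trans h4, g5.trans h5⟩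
    · simp [Exp.code, execAll_append, h1, g1, execAll, Instr.exec]
    · simp only [Exp.eval, Function.update_self]
      rw [g2, g3 _ (.inr (by omega)), h2]
    · simp only
      rw [Function.update_of_ne (by omega), g3 _ (by omega), h3 _ hi]
  | sub e f ihe ihf =>
    intro c hc
    obtain ⟨c₁, h1, h2, h3, h4, h5⟩ := ihe d c hc
    have hc₁ : Rep Λ s c₁ := hc.congr (fun i hi => h3 i (.inl hi)) h4 h5
    obtain ⟨c₂, g1, g2, g3, g4, g5⟩ := ihf (d + 1) c₁ hc₁
    refine ⟨{ c₂ with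
      pc := c₂.pc + 1
      mem := Function.update c₂.mem (8 * d) (c₂.mem (8 * d) - c₂.mem (8 * (d + 1))) },
      ?_, ?_, fun i hi => ?_, g4.trans h4, g5.trans h5⟩
    · simp [Exp.code, execAll_append, h1, g1, execAll, Instr.exec]
    · simp only [Exp.eval, Function.update_self]
      rw [g2, g3 _ (.inr (by omega)), h2]
    · simp only
      rw [Function.update_of_ne (by omega), g3 _ (by omega), h3 _ hi]

theorem isStraight_of_mem_addrCode (k : A) (e : Exp V) :
    ∀ I ∈ addrCode Λ k e, IsStraight I := by
  intro I hI
  simp only [addrCode, List.mem_append, List.mem_cons, List.not_mem_nil, or_false] at hI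
  rcases hI with h | rfl | rfl | rfl | rfl | rfl
  · exact e.isStraight_of_mem_code _ I h
  all_goals trivial

theorem execAll_addrCode (k : A) (e : Exp V) {s : State V A} {c : Config} (h : Rep Λ s c) :
    ∃ c', execAll (addrCode Λ k e) c = some c' ∧
      c'.mem 0 = 8 * e.eval s.var + 2 + Λ.arr k ∧ Rep Λ s c' := by
  obtain ⟨c₁, h1, h2, h3, h4⟩ := e.execAll_code 0 h
  rw [mul_zero] at h2
  simp only [addrCode, execAll_append, h1, Option.bind_some, execAll, Instr.exec]
  refine ⟨_, rfl, ?_, h4.congr (fun i hi => ?_) rfl rfl⟩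
  · simp [h2]
    ring
  · have : i ≠ 0 := by rintro rfl; simp at hi
    have : i ≠ 8 := by rintro rfl; simp at hi
    simp [*]

theorem Rep.setVar [DecidableEq V] {s : State V A} {c c' : Config} (h : Rep Λ s c) {x : V} {z : ℤ}
    (hm : c'.mem = Function.update c.mem (Λ.varAddr x) z) (hi : c'.input = c.input)
    (ho : c'.output = c.output) : Rep Λ (s.setVar x z) c' where
  var y := by
    rw [hm]
    by_cases hxy : y = x
    · subst hxy; simp [State.setVar, Layout.varAddr]
    · have : Λ.var y ≠ Λ.var x := fun e => hxy (Λ.var_inj e)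
      simp only [State.setVar]
      rw [Function.update_of_ne hxy, Function.update_of_ne, h.var]
      unfold Layout.varAddr; omega
  arr k i := by
    rw [hm, Function.update_of_ne, h.arr]; · rfl
    have := Λ.arr_lt k
    unfold Layout.varAddr; omega
  inp := hi.trans h.inp
  out := ho.trans h.out

theorem Rep.setArr [DecidableEq A] {s : State V A} {c c' : Config} (h : Rep Λ s c)
    {k : A} {i : ℕ} {z : ℤ} (hm : c'.mem = Function.update c.mem (8 * i + 2 + Λ.arr k) z)
    (hi : c'.input = c.input) (ho : c'.output = c.output) : Rep Λ (s.setArr k i z) c' where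
  var y := by
    rw [hm, Function.update_of_ne, h.var]; · rfl
    have := Λ.arr_lt k
    omega
  arr k' i' := by
    rw [hm]
    have h1 := Λ.arr_lt k
    have h2 := Λ.arr_lt k'
    simp only [State.setArr]
    by_cases hk : k' = k
    · subst hk
      rw [Function.update_self]
      by_cases hii : i' = i
      · subst hii; simp
      · rw [Function.update_of_ne hii, Function.update_of_ne (by omega), h.arr]
    · have : Λ.arr k' ≠ Λ.arr k := fun e => hk (Λ.arr_inj e)
      rw [Function.update_of_ne hk, Function.update_of_ne (by omega), h.arr]
  inp := hi.trans h.inp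
  out := ho.trans h.out

/-- Execution of the part of `P` that begins at `o` and has length `n` leads from the
configuration `c` to its end, in a configuration that represents `s'`, within `T` steps. -/
def Reaches (Λ : Layout V A) (P : Program) (o n : ℕ) (c : Config) (T : ℕ) (s' : State V A) :
    Prop :=
  ∃ t ≤ T, ∃ c', Ram.steps P t c = some c' ∧ c'.pc = o + n ∧ Rep Λ s' c'

theorem Reaches.of_straight {P : Program} {o : ℕ} {l : List Instr} (hl : CodeAt P o l)
    (hs : ∀ I ∈ l, IsStraight I) {c c' : Config} (hc : c.pc = o)
    (hcc' : execAll l c = some c') {s' : State V A} (h : Rep Λ s' c') :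
    Reaches Λ P o l.length c l.length s' :=
  ⟨_, le_rfl, c', (hl.steps_eq hs hc hcc').1, (hl.steps_eq hs hc hcc').2, h⟩

/-- Evaluation of a condition. -/
theorem Exp.steps_jumpPos {P : Program} {o m : ℕ} {e : Exp V} {l : List Instr}
    (hP : CodeAt P o (e.code Λ 0 ++ .jumpPos m 0 :: l)) {s : State V A} {c : Config}
    (hc : c.pc = o) (h : Rep Λ s c) :
    ∃ c', Ram.steps P ((e.code Λ 0).length + 1) c = some c' ∧ Rep Λ s c' ∧
      c'.pc = if 0 < e.eval s.var then m else o + (e.code Λ 0).length + 1 := by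
  obtain ⟨c₁, h1, h2, -, h4⟩ := e.execAll_code 0 h
  obtain ⟨g1, g2⟩ := hP.left.steps_eq (e.isStraight_of_mem_code 0) hc h1
  rw [mul_zero] at h2
  refine ⟨{ c₁ with pc := if 0 < e.eval s.var then m else o + (e.code Λ 0).length + 1 },
    steps_add (t' := 1) g1 ?_, h4.congr (fun _ _ => rfl) rfl rfl, rfl⟩
  simp only [Ram.steps, hP.right.step_eq g2, Instr.exec, h2, g2, Option.bind_some]

/-- An unconditional jump. -/
theorem steps_goto {P : Program} {o m : ℕ} {l : List Instr}
    (hP : CodeAt P o (.const 0 1 :: .jumpPos m 0 :: l)) {s : State V A} {c : Config}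
    (hc : c.pc = o) (h : Rep Λ s c) :
    ∃ c', Ram.steps P 2 c = some c' ∧ Rep Λ s c' ∧ c'.pc = m := by
  refine ⟨{ c with pc := m, mem := Function.update c.mem 0 1 }, ?_,
    h.congr (fun i hi => Function.update_of_ne (by rintro rfl; simp at hi) _ _) rfl rfl, rfl⟩
  simp only [Ram.steps, hP.step_eq hc, Instr.exec, Option.bind_some]
  rw [hP.tail.step_eq (by simp [hc])]
  simp [Instr.exec]

/-- Correctness of the translation. Each unit of time of the command costs at most as many steps
as there are instructions in its code. -/
theorem Runs.reaches [DecidableEq V] [DecidableEq A] {com : Cmd V A}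
    {s s' : State V A} {t : ℕ} (hr : Runs com s t s') (K : ℕ)
    {P : Program} {o : ℕ} (hP : CodeAt P o (com.code Λ o)) (hK : (com.code Λ o).length ≤ K)
    {c : Config} (hc : c.pc = o) (h : Rep Λ s c) :
    Reaches Λ P o (com.code Λ o).length c (K * t) s' := by
  induction hr generalizing o c with
  | skip s => exact ⟨0, Nat.zero_le _, c, rfl, hc, h⟩
  | assign s x e =>
    obtain ⟨c₁, h1, h2, h3, h4⟩ := e.execAll_code 0 h
    rw [mul_zero] at h2
    obtain ⟨t, ht, H⟩ := Reaches.of_straight hP (s' := s.setVar x (e.eval s.var))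
      (c' := { c₁ with
        pc := c₁.pc + 1 + 1
        mem := Function.update (Function.update c₁.mem 8 0) (Λ.varAddr x) (e.eval s.var) })
      (by
        intro I hI
        simp only [Cmd.code, List.mem_append, List.mem_cons, List.not_mem_nil, or_false] at hI
        rcases hI with hI | rfl | rfl
        · exact e.isStraight_of_mem_code _ I hI
        all_goals trivial) hc
      (by simp [Cmd.code, execAll_append, h1, execAll, Instr.exec, h2])
      ((h4.congr (c' := { c₁ with mem := Function.update c₁.mem 8 0 })
        (fun i hi => Function.update_of_ne (by rintro rfl; simp at hi) _ _) rfl rfl).setVar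
        rfl rfl rfl)
    exact ⟨t, by omega, H⟩
  | load s x k e he =>
    obtain ⟨c₁, h1, h2, h4⟩ := execAll_addrCode k e h
    have hpos : 0 ≤ c₁.mem 0 := by rw [h2]; positivity
    have haddr : (c₁.mem 0).toNat = 8 * (e.eval s.var).toNat + 2 + Λ.arr k := by
      rw [h2]; omega
    obtain ⟨t, ht, H⟩ := Reaches.of_straight hP
      (s' := s.setVar x (s.arr k (e.eval s.var).toNat))
      (c' := { c₁ with
        pc := c₁.pc + 1
        mem := Function.update c₁.mem (Λ.varAddr x) (s.arr k (e.eval s.var).toNat) })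
      (by
        intro I hI
        simp only [Cmd.code, List.mem_append, List.mem_cons, List.not_mem_nil, or_false] at hI
        rcases hI with hI | rfl
        · exact isStraight_of_mem_addrCode k e I hI
        · trivial) hc
      (by simp [Cmd.code, execAll_append, h1, execAll, Instr.exec, hpos, haddr, h4.arr])
      (h4.setVar rfl rfl rfl)
    exact ⟨t, by omega, H⟩
  | store s k e f he =>
    obtain ⟨c₁, h1, h2, h4⟩ := execAll_addrCode k e h
    obtain ⟨c₂, g1, g2, g3, g4⟩ := f.execAll_code 1 h4
    have hpos : 0 ≤ c₂.mem 0 := by rw [g3 _ (by omega), h2]; positivity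
    have haddr : (c₂.mem 0).toNat = 8 * (e.eval s.var).toNat + 2 + Λ.arr k := by
      rw [g3 _ (by omega), h2]; omega
    rw [mul_one] at g2
    obtain ⟨t, ht, H⟩ := Reaches.of_straight hP
      (s' := s.setArr k (e.eval s.var).toNat (f.eval s.var))
      (c' := { c₂ with
        pc := c₂.pc + 1
        mem := Function.update c₂.mem (8 * (e.eval s.var).toNat + 2 + Λ.arr k)
          (f.eval s.var) })
      (by
        intro I hI
        simp only [Cmd.code, List.mem_append, List.mem_cons, List.not_mem_nil, or_false] at hI
        rcases hI with hI | hI | rfl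
        · exact isStraight_of_mem_addrCode k e I hI
        · exact f.isStraight_of_mem_code _ I hI
        · trivial) hc
      (by simp [Cmd.code, execAll_append, h1, g1, execAll, Instr.exec, hpos, haddr, g2])
      (g4.setArr rfl rfl rfl)
    exact ⟨t, by omega, H⟩
  | read s x =>
    have h' := h.setVar (x := x) (z := s.inp.headD 0)
      (c' := { c with mem := Function.update c.mem (Λ.varAddr x) (s.inp.headD 0) }) rfl rfl rfl
    obtain ⟨t, ht, H⟩ := Reaches.of_straight hP
      (s' := { s.setVar x (s.inp.headD 0) with inp := s.inp.tail })
      (c' := { c with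
        pc := c.pc + 1
        mem := Function.update c.mem (Λ.varAddr x) (s.inp.headD 0)
        input := s.inp.tail })
      (by simp [Cmd.code, IsStraight]) hc (by simp [Cmd.code, execAll, Instr.exec, h.inp])
      ⟨h'.var, h'.arr, rfl, h'.out⟩
    exact ⟨t, by omega, H⟩
  | print s e =>
    obtain ⟨c₁, h1, h2, h3, h4⟩ := e.execAll_code 0 h
    rw [mul_zero] at h2
    obtain ⟨t, ht, H⟩ := Reaches.of_straight hP
      (s' := { s with out := s.out ++ [e.eval s.var] })
      (c' := { c₁ with pc := c₁.pc + 1, output := s.out ++ [e.eval s.var] })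
      (by
        intro I hI
        simp only [Cmd.code, List.mem_append, List.mem_cons, List.not_mem_nil, or_false] at hI
        rcases hI with hI | rfl
        · exact e.isStraight_of_mem_code _ I hI
        · trivial) hc
      (by simp [Cmd.code, execAll_append, h1, execAll, Instr.exec, h2, h4.out])
      ⟨h4.var, h4.arr, h4.inp, rfl⟩
    exact ⟨t, by omega, H⟩
  | @seq com com' s s' s'' t t' _ _ ih ih' =>
    simp only [Cmd.code, List.length_append] at hP hK ⊢
    obtain ⟨u, hu, c₁, h1, h2, h3⟩ := ih hP.left (by omega) hc h
    obtain ⟨u', hu', c₂, g1, g2, g3⟩ := ih' hP.right (by omega) h2 h3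
    exact ⟨u + u', by rw [mul_add]; omega, c₂, steps_add h1 g1, by omega, g3⟩
  | @ite_pos e com com' s t s' he _ ih =>
    simp only [Cmd.code, List.length_append, List.length_cons, List.length_nil] at hP hK ⊢
    obtain ⟨c₁, h1, h2, h3⟩ := Exp.steps_jumpPos (hP.left) hc h
    rw [if_pos he] at h3
    have hP' := hP.right.right
    simp only [List.length_append, List.length_cons, List.length_nil, zero_add, Nat.reduceAdd,
      ← add_assoc] at hP' hK h3 ⊢
    obtain ⟨u, hu, c₂, g1, g2, g3⟩ := ih hP' (by omega) h3 h2
    exact ⟨_, by rw [mul_add]; omega, c₂, steps_add h1 g1, by omega, g3⟩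
  | @ite_neg e com com' s t s' he _ ih =>
    simp only [Cmd.code, List.length_append, List.length_cons, List.length_nil] at hP hK ⊢
    obtain ⟨c₁, h1, h2, h3⟩ := Exp.steps_jumpPos (hP.left) hc h
    rw [if_neg he] at h3
    have hP' := hP.right.left
    simp only [List.length_append, List.length_cons, List.length_nil, zero_add,
      Nat.reduceAdd, ← add_assoc] at hP' hK h3 ⊢
    obtain ⟨u, hu, c₂, g1, g2, g3⟩ := ih hP'.left (by omega) h3 h2
    obtain ⟨c₃, k1, k2, k3⟩ := steps_goto hP'.right g2 g3
    exact ⟨_, by rw [mul_add]; omega, c₃, steps_add (steps_add h1 g1) k1, by omega, k2⟩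
  | @loop_pos e com s t s' t' s'' he _ _ ih ih' =>
    have hP0 := hP
    have hK0 := hK
    simp only [Cmd.code, List.length_append, List.length_cons, List.length_nil] at hP hK
    obtain ⟨c₁, h1, h2, h3⟩ := Exp.steps_jumpPos (hP.left) hc h
    rw [if_pos he] at h3
    have hP' := hP.right
    simp only [List.length_append, List.length_cons, List.length_nil, zero_add,
      Nat.reduceAdd, ← add_assoc] at hP' hK h3
    obtain ⟨u, hu, c₂, g1, g2, g3⟩ := ih hP'.left (by omega) h3 h2
    obtain ⟨c₃, k1, k2, k3⟩ := steps_goto hP'.right g2 g3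
    obtain ⟨u', hu', c₄, m1, m2, m3⟩ := ih' hP0 hK0 k3 k2
    exact ⟨_, by rw [mul_add, mul_add]; omega, c₄,
      steps_add (steps_add (steps_add h1 g1) k1) m1, m2, m3⟩
  | @loop_neg e com s he =>
    simp only [Cmd.code, List.length_append, List.length_cons, List.length_nil] at hP hK ⊢
    obtain ⟨c₁, h1, h2, h3⟩ := Exp.steps_jumpPos (hP.left) hc h
    rw [if_neg he] at h3
    have hP' := hP.left.right.tail
    obtain ⟨c₃, k1, k2, k3⟩ := steps_goto hP' h3 h2
    exact ⟨_, by omega, c₃, steps_add h1 k1, by omega, k2⟩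

end Compiler

/-! ### The decision procedure -/

/-- The variables of the decision procedure. -/
inductive Var : Type
  | go | f | x | w | p | n | k | u | y | z | j | c | ok | first
  deriving DecidableEq

/-- The arrays of the decision procedure: forms and numbers of the instructions, states of the
registers, the registers that are read more than once, and the two components of `table`. The state
of a register is 0 or 1 if no or one read instruction for it has been found, and otherwise 2 or 3,
where 3 means that a one is tried as its content. -/
inductive Arr : Type
  | form | num | state | twice | sets | rank
  deriving DecidableEq

/-- Numbers for the variables and arrays. -/
def layout : Layout Var Arr where
  var
    | .go => 0 | .f => 1 | .x => 2 | .w => 3 | .p => 4 | .n => 5 | .k => 6 | .u => 7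
    | .y => 8 | .z => 9 | .j => 10 | .c => 11 | .ok => 12 | .first => 13
  arr
    | .form => 0 | .num => 1 | .state => 2 | .twice => 3 | .sets => 4 | .rank => 5
  var_inj := by intro a b h; cases a <;> cases b <;> first | rfl | simp at h
  arr_inj := by intro a b h; cases a <;> cases b <;> first | rfl | simp at h
  arr_lt := by intro k; cases k <;> decide

instance : Coe Var (Exp Var) := ⟨.var⟩
instance : Add (Exp Var) := ⟨.add⟩
instance : Sub (Exp Var) := ⟨.sub⟩
instance (n : ℕ) : OfNat (Exp Var) n := ⟨.const n⟩

@[simp] theorem eval_var (v : Var → ℤ) (a : Var) : (Exp.var a).eval v = v a := rfl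
@[simp] theorem eval_add (v : Var → ℤ) (e f : Exp Var) : (e + f).eval v = e.eval v + f.eval v := rfl
@[simp] theorem eval_sub (v : Var → ℤ) (e f : Exp Var) : (e - f).eval v = e.eval v - f.eval v := rfl
@[simp] theorem eval_zero (v : Var → ℤ) : (0 : Exp Var).eval v = 0 := rfl
@[simp] theorem eval_one (v : Var → ℤ) : (1 : Exp Var).eval v = 1 := rfl
@[simp] theorem eval_two (v : Var → ℤ) : (2 : Exp Var).eval v = 2 := rfl
@[simp] theorem eval_three (v : Var → ℤ) : (3 : Exp Var).eval v = 3 := rfl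
@[simp] theorem eval_eight (v : Var → ℤ) : (8 : Exp Var).eval v = 8 := rfl
@[simp] theorem eval_ten (v : Var → ℤ) : (10 : Exp Var).eval v = 10 := rfl

/-- Sequential composition. -/
infixr:60 " ;; " => Cmd.seq

section Program

open Cmd Var Arr

/-- Reading of one instruction. -/
def readBody : Cmd Var Arr :=
  read f ;; read x ;; store form p f ;; store num p x ;; assign p (p + 1) ;;
  assign go (f - 1) ;;
  ite (f - 8)
    (load w state x ;;
      ite w
        (ite (2 - w) (store state x 2 ;; store twice k x ;; assign k (k + 1)) skip)
        (store state x 1 ;; assign n (n + 1)))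
    skip

/-- Reading of the input, up to the first halt instruction. -/
def readInput : Cmd Var Arr := assign go 1 ;; loop go readBody

/-- Preparation of the main loop. Here `p = L + 2`, so `z = 2 (L + 1) - 3 n`, and the main loop is
skipped if more than `2 z` registers are read more than once, in accordance with
`Correct.card_le`. -/
def prepare : Cmd Var Arr :=
  store sets (p - 2) 1 ;; store rank (p - 1) 1 ;; assign first 1 ;;
  assign z (p + p - n - n - n - 2) ;; assign go (z + z - k + 1) ;;
  ite go (assign ok 1) (assign ok 0)

/-- Computation of `table` at one position. For a read instruction, `u` is the entry of `sets` that
belongs to the reply one, and `y` and `z` are the entries of `sets` and `rank` that belong to the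
reply zero. -/
def tableBody : Cmd Var Arr :=
  assign j (j - 1) ;; load f form j ;; load x num j ;;
  ite (f - 8)
    (load w state x ;;
      ite (10 - f)
        (load u sets (j + 1) ;; load y sets (j + 2) ;; load z rank (j + 2))
        (load u sets (j + 2) ;; load y sets (j + 1) ;; load z rank (j + 1)) ;;
      ite (w - 1)
        (ite (w - 2) (assign y u) skip)
        (ite u (ite z (assign z (z + 1)) skip) (assign y 0 ;; assign z 0)) ;;
      store sets j y ;; store rank j z)
    (load u sets (j + x) ;; store sets j u ;; load u rank (j + x) ;; store rank j u)

/-- Computation of `table`. -/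
def tablePass : Cmd Var Arr := assign j (p - 2) ;; loop j tableBody

/-- Test of the entry of `table` at the first instruction. The contents that are tried first are
zero. -/
def check : Cmd Var Arr :=
  ite first
    (load z rank 0 ;; ite (z + k - n) skip (assign ok 0))
    (load u sets 0 ;; ite u skip (assign ok 0)) ;;
  assign first 0

/-- Addition of a carry to one digit of the binary counter. -/
def nextBody : Cmd Var Arr :=
  load x twice j ;;
  ite c
    (load w state x ;; ite (w - 2) (store state x 2) (store state x 3 ;; assign c 0))
    skip ;;
  assign j (j + 1)

/-- Addition of one to the binary counter that is formed by the contents of the registers that are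
read more than once. -/
def nextPass : Cmd Var Arr := assign c 1 ;; assign j 0 ;; loop (k - j) nextBody

/-- The treatment of one choice of contents. -/
def mainBody : Cmd Var Arr := tablePass ;; check ;; nextPass ;; assign go (1 - c)

/-- The decision procedure. -/
def procedure : Cmd Var Arr := readInput ;; prepare ;; loop go mainBody ;; print ok

end Program

/-! ### Reading the input -/

/-- The first integer that represents an instruction. -/
def Op.form {ι : Type} : Op ι → ℤ
  | .read true _ => 9
  | .read false _ => 15
  | .jump _ => 2

/-- The second integer that represents an instruction; registers are counted from 1. -/
def Op.num {n : ℕ} : Op (Fin n) → ℤ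
  | .read _ i => (i : ℤ) + 1
  | .jump l => (l : ℤ) + 1

variable {n : ℕ}

/-- The memory holds the program `Y`, a list `l` of registers and the number `N`; there are `d`
more instructions. -/
structure Loaded (Y : List (Op (Fin n))) (d : ℕ) (l : List (Fin n)) (N : ℕ) (s : State Var Arr) :
    Prop where
  p : s.var .p = Y.length + d
  form : ∀ (q : ℕ) u, Y[q]? = some u → s.arr .form q = u.form
  num : ∀ (q : ℕ) u, Y[q]? = some u → s.arr .num q = u.num
  k : s.var .k = l.length
  twice : ∀ (j : ℕ) (i : Fin n), l[j]? = some i → s.arr .twice j = (i : ℤ) + 1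
  n : s.var .n = N
  out : s.out = []

/-- The result of reading the part `Y` of the input and `d` more instructions. -/
structure HasRead (Y : List (Op (Fin n))) (d : ℕ) (l : List (Fin n)) (s : State Var Arr) :
    Prop where
  loaded : Loaded Y d l (Finset.univ.filter fun i => 0 < readCount i Y).card s
  nodup : l.Nodup
  mem_iff : ∀ i, i ∈ l ↔ 2 ≤ readCount i Y
  state : ∀ i : Fin n, s.arr .state (i + 1) = min (readCount i Y) 2
  sets : ∀ q, s.arr .sets q = 0
  rank : ∀ q, s.arr .rank q = 0

theorem readCount_singleton_read {ι : Type} [DecidableEq ι] (i j : ι) (sg : Bool) :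
    readCount i [.read sg j] = if j = i then 1 else 0 := by
  simp [readCount, List.countP_cons]

theorem readCount_singleton_jump {ι : Type} [DecidableEq ι] (i : ι) (l : ℕ) :
    readCount i [.jump l] = 0 := by
  simp [readCount]

/-- Reading of one of the two instructions `out.set:1 ; !` at the end. -/
theorem HasRead.wp_end {Y : List (Op (Fin n))} {d : ℕ} {l : List (Fin n)} {s : State Var Arr}
    (h : HasRead Y d l s) {f x : ℤ} {r : List ℤ} (hs : s.inp = f :: x :: r) (hf : f ≤ 8) :
    wp readBody (fun s' => HasRead Y (d + 1) l s' ∧ s'.inp = r ∧ s'.var .go = f - 1) s := by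
  have hp := h.loaded.p
  simp only [readBody, wp, State.setVar, State.setArr, hs, eval_var, eval_add, eval_sub,
    eval_one, eval_two, eval_eight, Function.update_apply, reduceCtorEq, if_true, if_false,
    List.headD_cons, List.tail_cons, hp]
  have e1 : ((Y.length : ℤ) + d).toNat = Y.length + d := by omega
  refine ⟨by omega, by omega, fun hpos => absurd hpos (by omega), fun _ => ⟨?_, trivial, trivial⟩⟩
  refine ⟨⟨?_, ?_, ?_, ?_, ?_, ?_, ?_⟩, h.nodup, h.mem_iff, ?_, ?_, ?_⟩
  · simp; ring
  · intro q u hq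
    have := (List.getElem?_eq_some_iff.1 hq).1
    simp only [e1]
    simp [show q ≠ Y.length + d by omega, h.loaded.form q u hq]
  · intro q u hq
    have := (List.getElem?_eq_some_iff.1 hq).1
    simp only [e1]
    simp [show q ≠ Y.length + d by omega, h.loaded.num q u hq]
  · simpa using h.loaded.k
  · simpa using h.loaded.twice
  · simpa using h.loaded.n
  · simpa using h.loaded.out
  · simpa using h.state
  · simpa using h.sets
  · simpa using h.rank

/-- Reading of an instruction of the body. -/
theorem HasRead.wp_op {Y : List (Op (Fin n))} {l : List (Fin n)} {s : State Var Arr}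
    (h : HasRead Y 0 l s) (u : Op (Fin n)) {r : List ℤ} (hs : s.inp = u.form :: u.num :: r) :
    wp readBody (fun s' => (∃ l', HasRead (Y ++ [u]) 0 l' s') ∧ s'.inp = r ∧ 0 < s'.var .go) s := by
  have hp := h.loaded.p
  have hget : ∀ (g : Op (Fin n) → ℤ) (t : ℕ → ℤ), (∀ (q : ℕ) v, Y[q]? = some v → t q = g v) →
      ∀ (q : ℕ) v, (Y ++ [u])[q]? = some v → (if q = Y.length then g u else t q) = g v := by
    intro g t ht q v hq
    rw [List.getElem?_append] at hq
    split_ifs at hq with hlt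
    · rw [if_neg hlt.ne, ht q v hq]
    · have := (List.getElem?_eq_some_iff.1 hq).1
      have e : q = Y.length := by simp at this; omega
      subst e
      simp at hq
      rw [if_pos rfl, hq]
  have hform := hget _ _ h.loaded.form
  have hnum := hget _ _ h.loaded.num
  simp only [readBody, wp, State.setVar, State.setArr, hs, eval_var, eval_add, eval_sub,
    eval_one, eval_two, eval_eight, Function.update_apply, reduceCtorEq, if_true, if_false,
    List.headD_cons, List.tail_cons, hp]
  simp only [Nat.cast_zero, add_zero, Int.toNat_natCast, Nat.cast_nonneg, true_and]
  cases u with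
  | jump m =>
    refine ⟨fun hpos => absurd hpos (by simp [Op.form]), fun _ => ⟨⟨l, ?_⟩, by simp [Op.form]⟩⟩
    have hcount : ∀ i, readCount i (Y ++ [.jump m]) = readCount i Y := by
      intro i; rw [readCount_append, readCount_singleton_jump, add_zero]
    refine ⟨⟨?_, ?_, ?_, ?_, ?_, ?_, ?_⟩, h.nodup, ?_, ?_, ?_, ?_⟩
    · simp
    · simpa [Function.update_apply] using hform
    · simpa [Function.update_apply] using hnum
    · simpa using h.loaded.k
    · simpa using h.loaded.twice
    · simpa [hcount] using h.loaded.n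
    · simpa using h.loaded.out
    · simpa [hcount] using h.mem_iff
    · simpa [hcount] using h.state
    · simpa using h.sets
    · simpa using h.rank
  | read sg i =>
    have hform8 : 8 < (Op.read sg i).form := by cases sg <;> simp [Op.form]
    have hnumi : (Op.read sg i).num.toNat = (i : ℕ) + 1 := by simp [Op.num]
    have hnum0 : 0 ≤ (Op.read sg i).num := by simp [Op.num]; omega
    have hcount : ∀ j,
        readCount j (Y ++ [.read sg i]) = readCount j Y + if i = j then 1 else 0 := by
      intro j; rw [readCount_append, readCount_singleton_read]
    have hk := h.loaded.k
    have hn := h.loaded.n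
    have hstay : ∀ (j : Fin n), j ≠ i → readCount j (Y ++ [.read sg i]) = readCount j Y := by
      intro j hj; rw [hcount, if_neg (Ne.symm hj), add_zero]
    have hself : readCount i (Y ++ [.read sg i]) = readCount i Y + 1 := by
      rw [hcount, if_pos rfl]
    refine ⟨fun _ => ⟨hnum0, ?_⟩, fun hneg => absurd hneg (by omega)⟩
    simp only [hnumi, h.state i, hk, hn]
    have hposcard : 0 < readCount i Y →
        (Finset.univ.filter fun j => 0 < readCount j (Y ++ [.read sg i])) =
        (Finset.univ.filter fun j => 0 < readCount j Y) := by
      intro h0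
      ext j
      simp only [Finset.mem_filter, Finset.mem_univ, true_and]
      by_cases hj : j = i
      · subst hj; rw [hself]; omega
      · rw [hstay j hj]
    refine ⟨fun hw => ⟨fun hw2 => ⟨hnum0, by omega, ⟨l ++ [i], ?_⟩, by omega⟩, fun hw2 => ?_⟩,
      fun hw => ⟨hnum0, ⟨l, ?_⟩, by omega⟩⟩
    · have hc1 : readCount i Y = 1 := by omega
      have hil : i ∉ l := by rw [h.mem_iff]; omega
      refine ⟨⟨?_, ?_, ?_, ?_, ?_, ?_, ?_⟩, ?_, ?_, ?_, ?_, ?_⟩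
      · simp
      · simpa [Function.update_apply] using hform
      · simpa [Function.update_apply] using hnum
      · simp
      · intro j i' hj
        rw [List.getElem?_append] at hj
        split_ifs at hj with hlt
        · simp [hlt.ne, h.loaded.twice j i' hj]
        · have := (List.getElem?_eq_some_iff.1 hj).1
          have e : j = l.length := by simp at this; omega
          subst e
          simp at hj
          subst hj
          simp [Op.num]
      · rw [hposcard (by omega)]
        simpa using hn
      · simpa using h.loaded.out
      · rw [List.nodup_append]
        refine ⟨h.nodup, by simp, ?_⟩
        intro a ha b hb
        simp only [List.mem_singleton] at hb
        subst hb
        rintro rfl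
        exact hil ha
      · intro j
        by_cases hj : j = i
        · subst hj; rw [hself]; simp; omega
        · rw [hstay j hj, ← h.mem_iff]; simp [hj]
      · intro j
        by_cases hj : j = i
        · subst hj; rw [hself]; simp; omega
        · rw [hstay j hj, ← h.state j]
          have : (j : ℕ) ≠ i := fun e => hj (Fin.ext e)
          simp [this]
      · simpa using h.sets
      · simpa using h.rank
    · have hc2 : 2 ≤ readCount i Y := by omega
      refine ⟨⟨l, ⟨⟨?_, ?_, ?_, ?_, ?_, ?_, ?_⟩, h.nodup, ?_, ?_, ?_, ?_⟩⟩, by omega⟩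
      · simp
      · simpa [Function.update_apply] using hform
      · simpa [Function.update_apply] using hnum
      · simpa using hk
      · simpa using h.loaded.twice
      · rw [hposcard (by omega)]
        simpa using hn
      · simpa using h.loaded.out
      · intro j
        rw [h.mem_iff]
        by_cases hj : j = i
        · subst hj; rw [hself]; omega
        · rw [hstay j hj]
      · intro j
        by_cases hj : j = i
        · subst hj; rw [hself]; simp [h.state]; omega
        · rw [hstay j hj, ← h.state j]; simp
      · simpa using h.sets
      · simpa using h.rank
    · have hc0 : readCount i Y = 0 := by omega
      refine ⟨⟨?_, ?_, ?_, ?_, ?_, ?_, ?_⟩, h.nodup, ?_, ?_, ?_, ?_⟩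
      · simp
      · simpa [Function.update_apply] using hform
      · simpa [Function.update_apply] using hnum
      · simpa using hk
      · simpa using h.loaded.twice
      · have : (Finset.univ.filter fun j => 0 < readCount j (Y ++ [.read sg i])) =
            insert i (Finset.univ.filter fun j => 0 < readCount j Y) := by
          ext j
          simp only [Finset.mem_filter, Finset.mem_univ, true_and, Finset.mem_insert]
          by_cases hj : j = i
          · subst hj; rw [hself]; simp
          · rw [hstay j hj]; simp [hj]
        rw [this, Finset.card_insert_of_notMem (by simp [hc0])]
        simp
      · simpa using h.loaded.out
      · intro j
        rw [h.mem_iff]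
        by_cases hj : j = i
        · subst hj; rw [hself]; omega
        · rw [hstay j hj]
      · intro j
        by_cases hj : j = i
        · subst hj; rw [hself]; simp; omega
        · rw [hstay j hj, ← h.state j]
          have : (j : ℕ) ≠ i := fun e => hj (Fin.ext e)
          simp [this]
      · simpa using h.sets
      · simpa using h.rank

theorem loop_readBody_ends (Y' Y : List (Op (Fin n))) {l : List (Fin n)} {s : State Var Arr}
    (h : HasRead Y 0 l s)
    (hs : s.inp = Y'.flatMap (fun u => [u.form, u.num]) ++ [5, -1, 1, -1])
    (hgo : 0 < s.var .go) :
    Ends (.loop Var.go readBody) s ((Y'.length + 2) * (readBody.size + 1) + 1)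
      (fun s' => ∃ l', HasRead (Y ++ Y') 2 l' s') := by
  induction Y' generalizing Y l s with
  | nil =>
    refine .loop_pos hgo (.of_wp (h.wp_end (by simpa using hs) (by norm_num)))
      (fun s₁ h₁ => .loop_pos (by simp [h₁.2.2])
        (.of_wp (h₁.1.wp_end h₁.2.1 (by norm_num)))
        (fun s₂ h₂ => .loop_neg (by simp [h₂.2.2]) le_rfl ⟨l, by simpa using h₂.1⟩) le_rfl)
      (by simp; omega)
  | cons u Y' ih =>
    refine .loop_pos hgo (.of_wp (h.wp_op u (by simpa using hs)))
      (fun s₁ ⟨⟨l', h₁⟩, hs₁, hgo₁⟩ => (ih (Y ++ [u]) h₁ hs₁ hgo₁).mono le_rfl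
        fun s₂ h₂ => by simpa using h₂) ?_
    simp only [List.length_cons, Nat.add_mul]
    omega

theorem readInput_ends (Y : List (Op (Fin n))) :
    Ends readInput
      ⟨fun _ => 0, fun _ _ => 0, Y.flatMap (fun u => [u.form, u.num]) ++ [5, -1, 1, -1], []⟩
      ((Y.length + 2) * (readBody.size + 1) + 2)
      (fun s' => ∃ l, HasRead Y 2 l s') := by
  refine .seq (.of_wp (Q := fun s' => HasRead ([] : List (Op (Fin n))) 0 [] s' ∧ s'.inp =
    Y.flatMap (fun u => [u.form, u.num]) ++ [5, -1, 1, -1] ∧ 0 < s'.var .go) ?_)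
    (fun s₁ ⟨h₁, hs₁, hgo₁⟩ => (loop_readBody_ends Y [] h₁ hs₁ hgo₁).mono le_rfl
        fun s₂ h₂ => by simpa using h₂) (by simp [Cmd.size]; omega)
  refine ⟨⟨⟨?_, ?_, ?_, ?_, ?_, ?_, ?_⟩, ?_, ?_, ?_, ?_, ?_⟩, rfl, ?_⟩ <;>
    simp [State.setVar, readCount]

/-! ### Computation of the table -/

/-- The memory holds `o` in `ok` and `f` in `first`, and the entries of `table` at the end of the
program are correct. -/
structure Base (Y : List (Op (Fin n))) (l : List (Fin n)) (o f : ℤ) (s : State Var Arr) :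
    Prop where
  loaded : Loaded Y 2 l n s
  sets : ∀ q, Y.length ≤ q → s.arr .sets q = if q = Y.length then 1 else 0
  rank : ∀ q, Y.length ≤ q → s.arr .rank q = if q = Y.length + 1 then 1 else 0
  ok : s.var .ok = o
  first : s.var .first = f

/-- The contents `a` are tried for the registers in `l`, and the other registers are marked as read
once. -/
def Tries (l : List (Fin n)) (a : Fin n → Bool) (s : State Var Arr) : Prop :=
  ∀ i : Fin n, s.arr .state (i + 1) = if i ∈ l then (if a i then 3 else 2) else 1

/-- The entries of `table` from position `r` on are correct. -/
structure TableInv (Y : List (Op (Fin n))) (l : List (Fin n)) (o f : ℤ) (a : Fin n → Bool)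
    (r : ℕ) (s : State Var Arr) : Prop where
  base : Base Y l o f s
  tries : Tries l a s
  j : s.var .j = r
  le : r ≤ Y.length
  fst : ∀ q, r ≤ q → s.arr .sets q = if (table l.toFinset a Y q).1 then 1 else 0
  snd : ∀ q, r ≤ q → s.arr .rank q = (table l.toFinset a Y q).2

/-- Storing the entries at position `r` extends the invariant. -/
theorem TableInv.store {Y : List (Op (Fin n))} {l : List (Fin n)} {o f : ℤ} {a : Fin n → Bool}
    {r : ℕ} {s s' : State Var Arr} (h : TableInv Y l o f a (r + 1) s)
    (harr : ∀ k q, s'.arr k q =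
      if k = .rank ∧ q = r then ((table l.toFinset a Y r).2 : ℤ)
      else if k = .sets ∧ q = r then (if (table l.toFinset a Y r).1 then 1 else 0)
      else s.arr k q)
    (hp : s'.var .p = s.var .p) (hk : s'.var .k = s.var .k) (hn : s'.var .n = s.var .n)
    (hok : s'.var .ok = s.var .ok) (hfirst : s'.var .first = s.var .first) (hj : s'.var .j = r)
    (hout : s'.out = s.out) : TableInv Y l o f a r s' := by
  have hle := h.le
  have hb := h.base
  refine ⟨⟨⟨hp.trans hb.loaded.p, ?_, ?_, hk.trans hb.loaded.k, ?_, hn.trans hb.loaded.n,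
    hout.trans hb.loaded.out⟩, ?_, ?_, hok.trans hb.ok, hfirst.trans hb.first⟩, ?_, hj, by omega,
    ?_, ?_⟩
  · intro q u hq
    simp [harr, hb.loaded.form q u hq]
  · intro q u hq
    simp [harr, hb.loaded.num q u hq]
  · intro j i hj
    simp [harr, hb.loaded.twice j i hj]
  · intro q hq
    simp [harr, hb.sets q hq, show q ≠ r by omega]
  · intro q hq
    simp [harr, hb.rank q hq, show q ≠ r by omega]
  · intro i
    simp [harr, h.tries i]
  · intro q hq
    by_cases hqr : q = r
    · subst hqr; simp [harr]
    · simp [harr, hqr, h.fst q (by omega)]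
  · intro q hq
    by_cases hqr : q = r
    · subst hqr; simp [harr]
    · simp [harr, hqr, h.snd q (by omega)]

theorem TableInv.wp_tableBody {Y : List (Op (Fin n))} {l : List (Fin n)} {o f : ℤ}
    {a : Fin n → Bool} {r : ℕ} {s : State Var Arr} (h : TableInv Y l o f a (r + 1) s) :
    wp tableBody (TableInv Y l o f a r) s := by
  have hlt : r < Y.length := h.le
  have hu := List.getElem?_eq_getElem hlt
  have hj : s.var .j - 1 = r := by rw [h.j]; push_cast; ring
  have e1 : ((r : ℤ) + 1).toNat = r + 1 := by omega
  have e2 : ((r : ℤ) + 2).toNat = r + 2 := by omega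
  have p1 : 0 ≤ (r : ℤ) + 1 := by omega
  have p2 : 0 ≤ (r : ℤ) + 2 := by omega
  simp only [tableBody, wp, State.setVar, State.setArr, eval_var, eval_add, eval_sub,
    eval_zero, eval_one, eval_two, eval_eight, eval_ten, Function.update_apply, reduceCtorEq,
    if_true, if_false, hj, h.base.loaded.form _ _ hu, h.base.loaded.num _ _ hu,
    Int.toNat_natCast, Nat.cast_nonneg, true_and, e1, e2, p1, p2]
  cases hop : Y[r] with
  | jump m =>
    rw [hop] at hu
    have e3 : ((r : ℤ) + ((m : ℤ) + 1)).toNat = r + 1 + m := by omega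
    have p3 : 0 ≤ (r : ℤ) + ((m : ℤ) + 1) := by omega
    refine ⟨fun hpos => absurd hpos (by simp [Op.form]), fun _ => ⟨p3, p3, ?_⟩⟩
    simp only [Op.num, e3]
    refine h.store (fun k q => ?_) rfl rfl rfl rfl rfl rfl rfl
    rw [table_jump _ hu]
    cases k <;> simp [Function.update_apply, h.fst (r + 1 + m) (by omega),
      h.snd (r + 1 + m) (by omega)]
  | read sg i =>
    rw [hop] at hu
    have hform8 : 0 < (Op.read sg i).form - 8 := by cases sg <;> simp [Op.form]
    have hnum : (Op.read sg i).num.toNat = (i : ℕ) + 1 := by simp [Op.num]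
    have hnum0 : 0 ≤ (Op.read sg i).num := by simp [Op.num]; omega
    refine ⟨fun _ => ⟨hnum0, ?_⟩, fun hneg => absurd hform8 hneg⟩
    simp only [hnum, h.tries i]
    have f1 := h.fst (r + 1) le_rfl
    have f2 := h.fst (r + 2) (by omega)
    have g1 := h.snd (r + 1) le_rfl
    have g2 := h.snd (r + 2) (by omega)
    by_cases hil : i ∈ l
    · have ht := table_read_mem (T := l.toFinset) a hu (by simpa using hil)
      cases sg <;> cases hai : a i <;> simp [hai, add_assoc] at ht
      all_goals
        simp only [hil, if_true, if_false, Op.form, f1, f2, g1, g2, Bool.false_eq_true]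
        norm_num
        refine h.store (fun k q => ?_) rfl rfl rfl rfl rfl rfl rfl
        cases k <;> simp [Function.update_apply, ht]
    · have ht := table_read_notMem (T := l.toFinset) a hu (by simpa using hil)
      cases sg <;> simp [add_assoc] at ht
      all_goals
        simp only [hil, if_false, Op.form, f1, f2, g1, g2]
        norm_num
        refine ⟨fun hw => ⟨fun hz => ?_, fun hz => ?_⟩, fun hw => ?_⟩
        all_goals
          refine h.store (fun k q => ?_) rfl rfl rfl rfl rfl rfl rfl
          cases k <;> simp [Function.update_apply, ht] <;> grind

theorem tablePass_ends {Y : List (Op (Fin n))} {l : List (Fin n)} {o f : ℤ} {a : Fin n → Bool}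
    {s : State Var Arr} (h : Base Y l o f s) (ha : Tries l a s) :
    Ends tablePass s (Y.length * (tableBody.size + 1) + 2) (TableInv Y l o f a 0) := by
  have hp : s.var .p - 2 = Y.length := by rw [h.loaded.p]; push_cast; ring
  refine .seq (.of_wp (Q := TableInv Y l o f a Y.length) ?_)
    (fun s₁ h₁ => Ends.loop_of_invariant (TableInv Y l o f a) (fun r s₂ h₂ =>
      ⟨by simp only [eval_var, h₂.j]; omega, .of_wp h₂.wp_tableBody⟩)
      (fun s₂ h₂ => by simp [h₂.j]) h₁) (by simp only [Cmd.size]; omega)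
  have hb := h.loaded
  simp only [wp, State.setVar, eval_sub, eval_var, eval_two, hp]
  refine ⟨⟨⟨?_, hb.form, hb.num, ?_, hb.twice, ?_, hb.out⟩, h.sets, h.rank, ?_, ?_⟩, ha, ?_, le_rfl,
    ?_, ?_⟩
  · simpa using hb.p
  · simpa using hb.k
  · simpa using hb.n
  · simpa using h.ok
  · simpa using h.first
  · simp
  · intro q hq
    rw [table_of_length_le _ hq]
    simpa using h.sets q hq
  · intro q hq
    rw [table_of_length_le _ hq]
    simpa using h.rank q hq

/-! ### The binary counter -/

/-- The number of which the contents `a` of the registers in `l` are the binary digits. -/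
def weight (l : List (Fin n)) (a : Fin n → Bool) : ℕ :=
  Nat.ofDigits 2 (l.map fun i => (a i).toNat)

theorem weight_append_singleton (l : List (Fin n)) (i : Fin n) (a : Fin n → Bool) :
    weight (l ++ [i]) a = weight l a + 2 ^ l.length * (a i).toNat := by
  simp [weight, Nat.ofDigits_append]

theorem weight_congr {l : List (Fin n)} {a a' : Fin n → Bool} (h : ∀ i ∈ l, a i = a' i) :
    weight l a = weight l a' := by
  unfold weight
  rw [List.map_congr_left fun i hi => by rw [h i hi]]

theorem weight_lt (l : List (Fin n)) (a : Fin n → Bool) : weight l a < 2 ^ l.length := by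
  have := Nat.ofDigits_lt_base_pow_length (b := 2) (l := l.map fun i => (a i).toNat) (by norm_num)
    (by simp only [List.mem_map]; rintro x ⟨i, -, rfl⟩; cases a i <;> simp)
  simpa [weight] using this

theorem eq_of_weight_eq {l : List (Fin n)} {a a' : Fin n → Bool} (h : weight l a = weight l a') :
    ∀ i ∈ l, a i = a' i := by
  have := Nat.ofDigits_inj_of_len_eq (b := 2) (by norm_num) (by simp)
    (by simp only [List.mem_map]; rintro x ⟨i, -, rfl⟩; cases a i <;> simp)
    (by simp only [List.mem_map]; rintro x ⟨i, -, rfl⟩; cases a' i <;> simp) h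
  intro i hi
  have := List.map_inj_left.1 this i hi
  revert this
  cases a i <;> cases a' i <;> simp

theorem weight_false (l : List (Fin n)) : weight l (fun _ => false) = 0 := by
  induction l with
  | nil => rfl
  | cons i l ih => simp_all [weight, Nat.ofDigits_cons]

/-- The contents `a` have been replaced by `a'` in the first `q` registers of `l`, with carry `d`,
where `r` registers are left. -/
structure NextInv (Y : List (Op (Fin n))) (l : List (Fin n)) (o f : ℤ) (a : Fin n → Bool)
    (a' : Fin n → Bool) (d q r : ℕ) (s : State Var Arr) : Prop where
  base : Base Y l o f s
  tries : Tries l a' s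
  j : s.var .j = q
  add : q + r = l.length
  c : s.var .c = d
  le : d ≤ 1
  weight : weight (l.take q) a' + 2 ^ q * d = weight (l.take q) a + 1
  eq : ∀ i, i ∉ l.take q → a' i = a i

/-- Replacing the content of register `l[q]` by `b`, with new carry `d'`. -/
theorem NextInv.next {Y : List (Op (Fin n))} {l : List (Fin n)} {o f : ℤ}
    {a a' : Fin n → Bool} {d q r : ℕ} {s s' : State Var Arr} (hl : l.Nodup)
    (h : NextInv Y l o f a a' d q (r + 1) s) {i : Fin n} (hi : l[q]? = some i) (b : Bool) (d' : ℕ)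
    (hd' : d' ≤ 1) (hsum : b.toNat + 2 * d' = (a i).toNat + d)
    (harr : ∀ k p, s'.arr k p =
      if k = .state ∧ p = i + 1 then (if b then 3 else 2) else s.arr k p)
    (hp : s'.var .p = s.var .p) (hk : s'.var .k = s.var .k) (hn : s'.var .n = s.var .n)
    (hok : s'.var .ok = s.var .ok) (hfirst : s'.var .first = s.var .first)
    (hj : s'.var .j = (q : ℤ) + 1) (hc : s'.var .c = d') (hout : s'.out = s.out) :
    NextInv Y l o f a (Function.update a' i b) d' (q + 1) r s' := by
  have hb := h.base.loaded
  have hadd := h.add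
  have htake : l.take (q + 1) = l.take q ++ [i] := by
    rw [List.take_add_one, hi]; rfl
  have hnot : i ∉ l.take q := by
    have := hl.sublist (List.take_sublist (q + 1) l)
    rw [htake, List.nodup_append] at this
    intro hmem
    exact this.2.2 i hmem i (by simp) rfl
  refine ⟨⟨⟨hp.trans hb.p, ?_, ?_, hk.trans hb.k, ?_, hn.trans hb.n, hout.trans hb.out⟩, ?_, ?_,
    hok.trans h.base.ok, hfirst.trans h.base.first⟩, ?_, by rw [hj]; simp, by omega, hc, hd', ?_,
    ?_⟩
  · intro p u hu
    simp [harr, hb.form p u hu]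
  · intro p u hu
    simp [harr, hb.num p u hu]
  · intro p i' hi'
    simp [harr, hb.twice p i' hi']
  · intro p hq
    simp [harr, h.base.sets p hq]
  · intro p hq
    simp [harr, h.base.rank p hq]
  · intro i'
    by_cases hii : i' = i
    · subst hii
      simp [harr, List.mem_of_getElem? hi]
    · have : (i' : ℕ) ≠ i := fun e => hii (Fin.ext e)
      simp [harr, this, h.tries i', Function.update_of_ne hii]
  · have e : NonzeroTest.weight (l.take q) (Function.update a' i b) =
        NonzeroTest.weight (l.take q) a' :=
      weight_congr fun i' hi' => Function.update_of_ne (by rintro rfl; exact hnot hi') _ _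
    have hlen : (l.take q).length = q := by simp; omega
    have hw := h.weight
    rw [htake, weight_append_singleton, weight_append_singleton, e, hlen, Function.update_self]
    have : 2 ^ q * b.toNat + 2 ^ (q + 1) * d' = 2 ^ q * (a i).toNat + 2 ^ q * d := by
      rw [pow_succ, ← mul_add, ← hsum]; ring
    omega
  · intro i' hi'
    rw [htake, List.mem_append, List.mem_singleton, not_or] at hi'
    rw [Function.update_of_ne hi'.2, h.eq i' hi'.1]

theorem NextInv.wp_nextBody {Y : List (Op (Fin n))} {l : List (Fin n)} {o f : ℤ}
    {a a' : Fin n → Bool} {d q r : ℕ} {s : State Var Arr} (hl : l.Nodup)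
    (h : NextInv Y l o f a a' d q (r + 1) s) :
    wp nextBody (fun s' => ∃ a'' d', NextInv Y l o f a a'' d' (q + 1) r s') s := by
  have hb := h.base.loaded
  have hlt : q < l.length := by have := h.add; omega
  obtain ⟨i, hi⟩ : ∃ i, l[q]? = some i := ⟨_, List.getElem?_eq_getElem hlt⟩
  have hil : i ∈ l := List.mem_of_getElem? hi
  have hnot : i ∉ l.take q := by
    have := hl.sublist (List.take_sublist (q + 1) l)
    rw [List.take_add_one, hi, Option.toList_some, List.nodup_append] at this
    intro hmem
    exact this.2.2 i hmem i (by simp) rfl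
  have e1 : ((i : ℤ) + 1).toNat = (i : ℕ) + 1 := by omega
  have p1 : 0 ≤ (i : ℤ) + 1 := by omega
  have hai : a' i = a i := h.eq i hnot
  have hst := h.tries i
  have hd := h.le
  rw [if_pos hil, hai] at hst
  simp only [nextBody, wp, State.setVar, State.setArr, eval_var, eval_add, eval_sub,
    eval_zero, eval_one, eval_two, eval_three, Function.update_apply, reduceCtorEq,
    if_true, if_false, h.j, Int.toNat_natCast, Nat.cast_nonneg, true_and,
    hb.twice q i hi, e1, p1, h.c, hst]
  refine ⟨fun hc => ⟨fun hw3 => ?_, fun hw2 => ?_⟩, fun hc => ?_⟩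
  · have ha1 : a i = true := by by_contra hne; simp [hne] at hw3
    refine ⟨_, _, h.next hl hi false 1 le_rfl (by simp [ha1]; omega) (fun k p => ?_)
      rfl rfl rfl rfl rfl rfl ?_ rfl⟩
    · cases k <;> simp [Function.update_apply]
    · simp [h.c]; omega
  · have ha0 : a i = false := by
      by_contra hne
      simp only [Bool.not_eq_false] at hne
      simp [hne] at hw2
    refine ⟨_, _, h.next hl hi true 0 (by omega) (by simp [ha0]; omega) (fun k p => ?_)
      rfl rfl rfl rfl rfl rfl rfl rfl⟩
    cases k <;> simp [Function.update_apply]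
  · refine ⟨_, _, h.next hl hi (a i) 0 (by omega) (by omega) (fun k p => ?_)
      rfl rfl rfl rfl rfl rfl ?_ rfl⟩
    · cases k <;> simp
      rintro rfl
      exact hst
    · simp [h.c]; omega

theorem nextPass_ends {Y : List (Op (Fin n))} {l : List (Fin n)} {o f : ℤ} {a : Fin n → Bool}
    {s : State Var Arr} (hl : l.Nodup) (h : Base Y l o f s) (ha : Tries l a s) :
    Ends nextPass s (l.length * (nextBody.size + 1) + 3)
      (fun s' => ∃ a' d, Base Y l o f s' ∧ Tries l a' s' ∧ s'.var .c = (d : ℕ) ∧ d ≤ 1 ∧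
        weight l a' + 2 ^ l.length * d = weight l a + 1) := by
  let I : ℕ → State Var Arr → Prop := fun r s => ∃ a' d q, NextInv Y l o f a a' d q r s
  have hloop : ∀ s, I l.length s →
      Ends (.loop (.var .k - .var .j) nextBody) s (l.length * (nextBody.size + 1) + 1) (I 0) := by
    intro s hs
    refine Ends.loop_of_invariant I ?_ ?_ hs
    · rintro r s ⟨a', d, q, h⟩
      refine ⟨?_, .mono (.of_wp (h.wp_nextBody hl)) le_rfl fun s' ⟨a'', d', h'⟩ => ⟨a'', d', _, h'⟩⟩
      have := h.add
      simp only [eval_sub, eval_var, h.base.loaded.k, h.j]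
      omega
    · rintro s ⟨a', d, q, h⟩
      have := h.add
      simp only [eval_sub, eval_var, h.base.loaded.k, h.j]
      omega
  have hb := h.loaded
  refine .seq (T := 1) (.of_wp (Q := fun s' => Base Y l o f s' ∧ Tries l a s' ∧ s'.var .c = 1) ?_)
    (fun s₁ h₁ => .seq (T := 1) (.of_wp (Q := I l.length) ?_)
      (fun s₂ h₂ => (hloop s₂ h₂).mono le_rfl ?_)
        (T'' := l.length * (nextBody.size + 1) + 2) (by omega)) (by omega)
  · refine ⟨⟨⟨?_, hb.form, hb.num, ?_, hb.twice, ?_, hb.out⟩, h.sets, h.rank, ?_, ?_⟩, ha, ?_⟩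
    · simpa [State.setVar] using hb.p
    · simpa [State.setVar] using hb.k
    · simpa [State.setVar] using hb.n
    · simpa [State.setVar] using h.ok
    · simpa [State.setVar] using h.first
    · simp [State.setVar]
  · obtain ⟨h, ha, hc⟩ := h₁
    have hb := h.loaded
    refine ⟨a, 1, 0, ⟨⟨?_, hb.form, hb.num, ?_, hb.twice, ?_, hb.out⟩, h.sets, h.rank, ?_, ?_⟩, ha,
      ?_, by simp, ?_, le_rfl, ?_, fun _ _ => rfl⟩
    · simpa [State.setVar] using hb.p
    · simpa [State.setVar] using hb.k
    · simpa [State.setVar] using hb.n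
    · simpa [State.setVar] using h.ok
    · simpa [State.setVar] using h.first
    · simp [State.setVar]
    · simpa [State.setVar] using hc
    · simp
  · rintro s' ⟨a', d, q, h'⟩
    have hq : q = l.length := h'.add
    subst hq
    have hw := h'.weight
    rw [List.take_length] at hw
    exact ⟨a', d, h'.base, h'.tries, h'.c, h'.le, hw⟩

/-! ### The main loop -/

theorem table_congr {ι : Type} [DecidableEq ι] {T : Finset ι} {Y : List (Op ι)} {a a' : ι → Bool}
    (h : ∀ i ∈ T, a i = a' i) (p : ℕ) : table T a Y p = table T a' Y p := by
  induction p using position_induction Y with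
  | last p hp => rw [table_of_length_le _ hp, table_of_length_le _ hp]
  | body p u hu ih =>
    cases u with
    | jump l => rw [table_jump _ hu, table_jump _ hu, ih _ (by omega)]
    | read sg i =>
      by_cases hi : i ∈ T
      · rw [table_read_mem _ hu hi, table_read_mem _ hu hi, ih _ (by omega), ih _ (by omega),
          h i hi]
      · rw [table_read_notMem _ hu hi, table_read_notMem _ hu hi, ih _ (by omega), ih _ (by omega)]

/-- The test that is applied to the choice `a` of the contents of the registers in `l`. -/
def Passes (Y : List (Op (Fin n))) (l : List (Fin n)) (a : Fin n → Bool) : Prop :=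
  if weight l a = 0 then n < (table l.toFinset a Y 0).2 + l.length
  else (table l.toFinset a Y 0).1 = true

theorem passes_congr {Y : List (Op (Fin n))} {l : List (Fin n)} {a a' : Fin n → Bool}
    (h : weight l a = weight l a') : Passes Y l a ↔ Passes Y l a' := by
  have e : table l.toFinset a Y 0 = table l.toFinset a' Y 0 :=
    table_congr (fun i hi => eq_of_weight_eq h i (by simpa using hi)) 0
  unfold Passes
  rw [e, h]

/-- Contents of weight zero are zero in all registers of `l`, so that `correct_iff_table`
applies. -/
theorem correct_iff_passes {Y : List (Op (Fin n))} {l : List (Fin n)} (hl : l.Nodup)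
    (hT : ∀ i ∉ l, readCount i Y ≤ 1) : Correct Y ↔ ∀ a, Passes Y l a := by
  have hw : ∀ a, weight l a = 0 ↔ ¬ ∃ i ∈ l.toFinset, a i = true := by
    intro a
    constructor
    · rintro h ⟨i, hi, hai⟩
      have := eq_of_weight_eq (h.trans (weight_false l).symm) i (by simpa using hi)
      simp [hai] at this
    · intro h
      rw [← weight_false l]
      exact weight_congr fun i hi => by
        by_contra hne
        exact h ⟨i, by simpa using hi, by simpa using hne⟩
  rw [correct_iff_table (T := l.toFinset) (by simpa using hT), List.toFinset_card_of_nodup hl,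
    Fintype.card_fin]
  constructor
  · rintro ⟨h0, h1⟩ a
    by_cases ha : weight l a = 0
    · rw [passes_congr (ha.trans (weight_false l).symm), Passes, if_pos (weight_false l)]
      exact h0
    · rw [Passes, if_neg ha]
      exact h1 a (by rwa [hw, not_not] at ha)
  · intro h
    refine ⟨?_, fun a ha => ?_⟩
    · have := h fun _ => false
      rwa [Passes, if_pos (weight_false l)] at this
    · have := h a
      rwa [Passes, if_neg (by rw [hw, not_not]; exact ha)] at this

open Classical in
theorem TableInv.wp_check {Y : List (Op (Fin n))} {l : List (Fin n)} {o f : ℤ} {a : Fin n → Bool}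
    {s : State Var Arr} (h : TableInv Y l o f a 0 s) (hf : f = if weight l a = 0 then 1 else 0) :
    wp check (fun s' => Base Y l (if Passes Y l a then o else 0) 0 s' ∧ Tries l a s') s := by
  have hb := h.base.loaded
  have key : ∀ s' : State Var Arr, s'.arr = s.arr → s'.out = s.out → s'.var .p = s.var .p →
      s'.var .k = s.var .k → s'.var .n = s.var .n → s'.var .first = 0 →
      s'.var .ok = (if Passes Y l a then o else 0) →
      Base Y l (if Passes Y l a then o else 0) 0 s' ∧ Tries l a s' := by
    intro s' harr hout hp hk hn hfirst hok
    refine ⟨⟨⟨hp.trans hb.p, ?_, ?_, hk.trans hb.k, ?_, hn.trans hb.n, hout.trans hb.out⟩, ?_, ?_,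
      hok, hfirst⟩, ?_⟩
    · rw [harr]; exact hb.form
    · rw [harr]; exact hb.num
    · rw [harr]; exact hb.twice
    · rw [harr]; exact h.base.sets
    · rw [harr]; exact h.base.rank
    · unfold Tries; rw [harr]; exact h.tries
  simp only [check, wp, State.setVar, eval_var, eval_add, eval_sub, eval_zero,
    Function.update_apply, reduceCtorEq, if_true, if_false, Int.toNat_zero, le_refl, true_and,
    h.base.first, h.fst 0 le_rfl, h.snd 0 le_rfl, hb.k, hb.n]
  by_cases hw : weight l a = 0
  · rw [if_pos hw] at hf
    subst hf
    refine ⟨fun _ => ⟨fun h1 => ?_, fun h1 => ?_⟩, fun h0 => absurd zero_lt_one h0⟩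
    · have hpass : Passes Y l a := by rw [Passes, if_pos hw]; omega
      exact key _ rfl rfl rfl rfl rfl rfl (by simpa [hpass] using h.base.ok)
    · have hpass : ¬ Passes Y l a := by rw [Passes, if_pos hw]; omega
      exact key _ rfl rfl rfl rfl rfl rfl (by simp [hpass])
  · rw [if_neg hw] at hf
    subst hf
    refine ⟨fun h0 => absurd h0 (lt_irrefl _), fun _ => ⟨fun h1 => ?_, fun h1 => ?_⟩⟩
    · have hpass : Passes Y l a := by
        rw [Passes, if_neg hw]
        by_contra hne
        simp [hne] at h1
      exact key _ rfl rfl rfl rfl rfl rfl (by simpa [hpass] using h.base.ok)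
    · have hpass : ¬ Passes Y l a := by
        rw [Passes, if_neg hw]
        intro he
        simp [he] at h1
      exact key _ rfl rfl rfl rfl rfl rfl (by simp [hpass])

open Classical in
/-- In the main loop `r` choices of contents are left, and the others have been tested. -/
structure MainInv (Y : List (Op (Fin n))) (l : List (Fin n)) (r : ℕ) (s : State Var Arr) :
    Prop where
  base : ∃ f, Base Y l (if ∀ a, weight l a + r < 2 ^ l.length → Passes Y l a then 1 else 0) f s ∧
    (0 < r → ∃ a, weight l a + r = 2 ^ l.length ∧ Tries l a s ∧
      f = if weight l a = 0 then 1 else 0)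
  go_pos : 0 < r → 0 < s.var .go
  go_zero : r = 0 → s.var .go = 0

theorem MainInv.mainBody_ends {Y : List (Op (Fin n))} {l : List (Fin n)} {r : ℕ}
    {s : State Var Arr} (hl : l.Nodup) (h : MainInv Y l (r + 1) s) :
    Ends mainBody s ((Y.length * (tableBody.size + 1) + 2) + (check.size +
      ((l.length * (nextBody.size + 1) + 3) + 1))) (MainInv Y l r) := by
  classical
  obtain ⟨⟨f, hb, h2⟩, -, -⟩ := h
  obtain ⟨a, hw, ha, hf⟩ := h2 (Nat.succ_pos r)
  refine .seq (tablePass_ends hb ha) (fun s₁ h₁ => .seq (.of_wp (h₁.wp_check hf))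
    (fun s₂ h₂ => .seq (nextPass_ends hl h₂.1 h₂.2) (fun s₃ h₃ => .of_wp ?_) le_rfl) le_rfl) le_rfl
  obtain ⟨a', d, hb, ha', hc, hd, hadd⟩ := h₃
  have hlt := weight_lt l a'
  have hok : (if Passes Y l a then
      (if ∀ a, weight l a + (r + 1) < 2 ^ l.length → Passes Y l a then (1 : ℤ) else 0) else 0) =
      if ∀ a, weight l a + r < 2 ^ l.length → Passes Y l a then 1 else 0 := by
    have : (∀ a, weight l a + r < 2 ^ l.length → Passes Y l a) ↔
        Passes Y l a ∧ ∀ a, weight l a + (r + 1) < 2 ^ l.length → Passes Y l a := by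
      constructor
      · exact fun h => ⟨h a (by omega), fun b hb => h b (by omega)⟩
      · rintro ⟨h, h'⟩ b hb
        by_cases e : weight l b = weight l a
        · exact (passes_congr e).2 h
        · exact h' b (by omega)
    simp only [this]
    by_cases h1 : Passes Y l a <;> simp [h1]
  rw [hok] at hb
  have hbl := hb.loaded
  have hgo : (d = 0 ∧ 0 < r) ∨ (d = 1 ∧ r = 0) := by
    rcases Nat.le_one_iff_eq_zero_or_eq_one.1 hd with rfl | rfl
    · left; exact ⟨rfl, by omega⟩
    · right; exact ⟨rfl, by omega⟩
  simp only [wp, State.setVar, eval_sub, eval_one, eval_var, hc]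
  refine ⟨⟨0, ⟨⟨?_, hbl.form, hbl.num, ?_, hbl.twice, ?_, hbl.out⟩, hb.sets, hb.rank, ?_, ?_⟩,
    fun hr => ⟨a', ?_, ha', ?_⟩⟩, fun hr => ?_, fun hr => ?_⟩
  · simpa using hbl.p
  · simpa using hbl.k
  · simpa using hbl.n
  · simpa using hb.ok
  · simpa using hb.first
  · rcases hgo with ⟨rfl, -⟩ | ⟨rfl, h⟩ <;> omega
  · rw [if_neg]
    rcases hgo with ⟨rfl, -⟩ | ⟨rfl, h⟩ <;> omega
  · have : d = 0 := by omega
    simp [this]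
  · have : d = 1 := by omega
    simp [this]

theorem HasRead.wp_prepare {Y : List (Op (Fin n))} {l : List (Fin n)} {s : State Var Arr}
    (hread : ∀ i, 0 < readCount i Y) (h : HasRead Y 2 l s) :
    wp prepare (fun s =>
      (l.length + 6 * n ≤ 4 * (Y.length + 1) ∧ MainInv Y l (2 ^ l.length) s) ∨
      (4 * (Y.length + 1) < l.length + 6 * n ∧ s.var .go ≤ 0 ∧ s.var .ok = 0 ∧ s.out = [])) s := by
  have hcount : (Finset.univ.filter fun i => 0 < readCount i Y).card = n := by
    rw [Finset.filter_true_of_mem fun i _ => hread i]; simp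
  have hb := h.loaded
  rw [hcount] at hb
  have e1 : ((Y.length : ℤ) + (2 : ℕ) - 2).toNat = Y.length := by omega
  have e2 : ((Y.length : ℤ) + (2 : ℕ) - 1).toNat = Y.length + 1 := by omega
  have p1 : 0 ≤ (Y.length : ℤ) + (2 : ℕ) - 2 := by omega
  have p2 : 0 ≤ (Y.length : ℤ) + (2 : ℕ) - 1 := by omega
  simp only [prepare, wp, State.setVar, State.setArr, eval_var, eval_add, eval_sub, eval_zero,
    eval_one, eval_two, Function.update_apply, reduceCtorEq, if_true, if_false, hb.p, hb.k, hb.n,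
    e1, e2, p1, p2, true_and]
  refine ⟨fun hgo => .inl ⟨by omega, ⟨⟨1, ⟨⟨?_, ?_, ?_, ?_, ?_, ?_, ?_⟩, ?_, ?_, ?_, ?_⟩,
    fun _ => ⟨fun _ => false, ?_, ?_, ?_⟩⟩, fun _ => ?_, fun h0 => ?_⟩⟩, fun hgo =>
    .inr ⟨by omega, ?_, ?_⟩⟩
  · simpa using hb.p
  · simpa using hb.form
  · simpa using hb.num
  · simpa using hb.k
  · simpa using hb.twice
  · simpa using hb.n
  · exact hb.out
  · intro q _
    simp [Function.update_apply, h.sets]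
  · intro q _
    simp [Function.update_apply, h.rank]
  · simp
  · simp
  · simp [weight_false]
  · intro i
    have := hread i
    by_cases hi : i ∈ l
    · have := (h.mem_iff i).1 hi
      simp [hi, h.state]; omega
    · have : ¬ 2 ≤ readCount i Y := fun h2 => hi ((h.mem_iff i).2 h2)
      simp [hi, h.state]; omega
  · simp [weight_false]
  · simp; omega
  · simp at h0
  · simp; omega
  · exact hb.out

/-- Correctness and running time of the decision procedure. At most `E` registers are read more than
once if the main loop is entered. -/
theorem procedure_ends {Y : List (Op (Fin n))} (hread : ∀ i, 0 < readCount i Y) {E : ℕ}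
    (hE : 4 * (Y.length + 1) ≤ 6 * n + E) :
    Ends procedure
      ⟨fun _ => 0, fun _ _ => 0, Y.flatMap (fun u => [u.form, u.num]) ++ [5, -1, 1, -1], []⟩
      (100 * (Y.length + 1) + 2 ^ E * (100 * (Y.length + n + 1)))
      (fun s => (Correct Y → s.out = [1]) ∧ (¬ Correct Y → s.out = [0])) := by
  classical
  refine .seq (readInput_ends Y) (T' := 20 + 2 ^ E * (100 * (Y.length + n + 1)))
    (fun s₁ ⟨l, h₁⟩ => ?_) (by simp [readBody, Cmd.size]; omega)
  have hl := h₁.nodup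
  have hT : ∀ i ∉ l, readCount i Y ≤ 1 := fun i hi => by
    have := h₁.mem_iff i
    by_contra hlt
    exact hi (this.2 (by omega))
  have hlcard : (Finset.univ.filter fun i => 2 ≤ readCount i Y).card = l.length := by
    rw [← List.toFinset_card_of_nodup hl]
    congr 1
    ext i
    simp [h₁.mem_iff]
  have hln : l.length ≤ n := by
    have := Finset.card_le_univ l.toFinset
    rwa [List.toFinset_card_of_nodup hl, Fintype.card_fin] at this
  refine .seq (.of_wp (h₁.wp_prepare hread)) (fun s₂ h₂ => .seq (T := 2 ^ E * ((Y.length *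
    (tableBody.size + 1) + 2) + (check.size + ((l.length * (nextBody.size + 1) + 3) + 1)) + 1) + 1)
    (R := fun s => s.out = [] ∧
    s.var .ok = if Correct Y then 1 else 0) ?_ (fun s₃ h₃ => .of_wp ?_) le_rfl) ?_
  · rcases h₂ with ⟨hle, h₂⟩ | ⟨hlt, hgo, hok, hout⟩
    · refine (Ends.loop_of_invariant (MainInv Y l) (fun r s h => ⟨?_, h.mainBody_ends hl⟩)
        (fun s h => ?_) h₂).mono ?_ fun s h => ?_
      · exact h.go_pos (Nat.succ_pos r)
      · simp [h.go_zero rfl]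
      · have : 2 ^ l.length ≤ 2 ^ E := Nat.pow_le_pow_right (by norm_num) (by omega)
        gcongr
      · obtain ⟨⟨f, hb, -⟩, -, -⟩ := h
        refine ⟨hb.loaded.out, hb.ok.trans ?_⟩
        simp only [add_zero, weight_lt, forall_const, correct_iff_passes hl hT]
    · refine .loop_neg (by simpa using hgo) (by omega) ⟨hout, ?_⟩
      rw [hok, if_neg]
      intro hY
      have := hY.card_le
      rw [hlcard, Fintype.card_fin] at this
      omega
  · obtain ⟨hout, hok⟩ := h₃
    simp only [wp, hout, eval_var, hok]
    constructor <;> intro h <;> simp [h]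
  · have h1 : prepare.size = 8 := rfl
    have h2 : tableBody.size = 28 := rfl
    have h3 : check.size = 10 := rfl
    have h4 : nextBody.size = 9 := rfl
    have h5 := Nat.mul_le_mul_left (2 ^ E) (show Y.length * (tableBody.size + 1) + 2 + (check.size +
      (l.length * (nextBody.size + 1) + 3 + 1)) + 1 ≤ 100 * (Y.length + n + 1) by
        rw [h2, h3, h4]; omega)
    have h6 : (Cmd.print (Exp.var Var.ok) : Cmd Var Arr).size = 1 := rfl
    omega

/-! ### From instruction sequences to abstract programs -/

open InSeq (PInstr BInstr InstrSeq posRead negRead setOut)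

/-- The primitive instruction that an abstract instruction stands for. -/
def Op.toPInstr : Op (Fin n) → PInstr
  | .read true i => posRead i.val.succPNat
  | .read false i => negRead i.val.succPNat
  | .jump l => .jump (l + 1)

theorem Op.code_toPInstr (u : Op (Fin n)) : u.toPInstr.code = [u.form, u.num] := by
  rcases u with ⟨_ | _, i⟩ | l <;>
    simp [Op.toPInstr, PInstr.code, BInstr.form, BInstr.num, Op.form, Op.num]

/-- Execution of a good instruction sequence. -/
theorem run_eq (Y : List (Op (Fin n))) {k : ℕ} (b : Fin n → Bool) (x : Fin k → Bool) (p : ℕ) :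
    (InSeq.run p (Y.map Op.toPInstr ++ [setOut, .halt]) ⟨b, false, x⟩).map InSeq.Env.out =
      result Y b p := by
  induction Y generalizing p with
  | nil =>
    rcases p with _ | _ | p
    · simp [InSeq.run, BInstr.exec, result, backward]
    · simp [InSeq.run, result, backward]
    · simp [InSeq.run, result, backward]
  | cons u Y ih =>
    cases p with
    | succ p => exact ih p
    | zero =>
      have h : result (u :: Y) b 0 = result Y b (u.skip b) := rfl
      rw [h, ← ih]
      rcases u with ⟨_ | _, i⟩ | l
      · cases hb : b i <;>
          simp [Op.toPInstr, InSeq.run, BInstr.exec, Op.skip, hb]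
      · cases hb : b i <;>
          simp [Op.toPInstr, InSeq.run, BInstr.exec, Op.skip, hb]
      · simp [Op.toPInstr, InSeq.run, Op.skip]

theorem computes_iff (Y : List (Op (Fin n))) :
    InSeq.Computes (Y.map Op.toPInstr ++ [setOut, .halt]) (InSeq.nzt n) ↔ Correct Y := by
  have h1 : ∀ (k : ℕ) (b : Fin n → Bool), (∃ e : InSeq.Env n k,
      InSeq.run 0 (Y.map Op.toPInstr ++ [setOut, .halt]) ⟨b, false, fun _ => false⟩ = some e ∧
        e.out = InSeq.nzt n b) ↔ ∃ r, result Y b 0 = some r ∧ (r = true ↔ ∃ i, b i = true) := by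
    intro k b
    rw [← run_eq Y (k := k) b (fun _ => false) 0]
    constructor
    · rintro ⟨e, he, ho⟩
      exact ⟨e.out, by rw [he]; rfl, by rw [ho, InSeq.nzt, decide_eq_true_iff]⟩
    · rintro ⟨r, hr, ho⟩
      obtain ⟨e, he, rfl⟩ := Option.map_eq_some_iff.1 hr
      refine ⟨e, he, ?_⟩
      rw [Bool.eq_iff_iff, ho, InSeq.nzt, decide_eq_true_iff]
  constructor
  · rintro ⟨k, h⟩ b
    exact (h1 k b).1 (h b)
  · intro h
    exact ⟨0, fun b => (h1 0 b).2 (h b)⟩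

/-- A good instruction sequence in which the registers `1, …, n` are read comes from an abstract
program. -/
theorem exists_abstract {X : InstrSeq} (hX : InSeq.Good X)
    (hn : InSeq.iregs X = {i : ℕ+ | (i : ℕ) ≤ n}) :
    ∃ Y : List (Op (Fin n)), X = Y.map Op.toPInstr ++ [setOut, .halt] ∧
      ∀ i, 0 < readCount i Y := by
  obtain ⟨Z, -, rfl, hZ⟩ := hX
  have hreg : ∀ i : ℕ+, (i : ℕ) ≤ n → ∃ j : Fin n, j.val.succPNat = i := by
    intro i hi
    exact ⟨⟨i.natPred, by have := i.natPred_add_one; omega⟩, i.succPNat_natPred⟩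
  have hlift : ∀ u ∈ Z, ∃ v : Op (Fin n), v.toPInstr = u := by
    intro u hu
    have hmem : u ∈ Z ++ [setOut, .halt] := List.mem_append_left _ hu
    rcases hZ u hu with ⟨i, rfl | rfl⟩ | ⟨l, hl, rfl⟩
    · have : i ∈ InSeq.iregs (Z ++ [setOut, .halt]) := .inl hmem
      rw [hn] at this
      obtain ⟨j, rfl⟩ := hreg i this
      exact ⟨.read true j, rfl⟩
    · have : i ∈ InSeq.iregs (Z ++ [setOut, .halt]) := .inr hmem
      rw [hn] at this
      obtain ⟨j, rfl⟩ := hreg i this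
      exact ⟨.read false j, rfl⟩
    · exact ⟨.jump (l - 1), by simp [Op.toPInstr, Nat.sub_add_cancel hl]⟩
  obtain ⟨Y, rfl⟩ : ∃ Y : List (Op (Fin n)), Y.map Op.toPInstr = Z := by
    clear hn hZ
    induction Z with
    | nil => exact ⟨[], rfl⟩
    | cons u Z ih =>
      obtain ⟨v, rfl⟩ := hlift u (by simp)
      obtain ⟨Y, rfl⟩ := ih fun u hu => hlift u (by simp [hu])
      exact ⟨v :: Y, rfl⟩
  refine ⟨Y, rfl, fun i => readCount_pos_iff.2 ?_⟩
  have hi : i.val.succPNat ∈ InSeq.iregs (Y.map Op.toPInstr ++ [setOut, .halt]) := by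
    rw [hn]; simp
  have hfind : ∀ sg : Bool, ((if sg then posRead i.val.succPNat else negRead i.val.succPNat) ∈
      Y.map Op.toPInstr ++ [setOut, .halt]) →
      ∃ (p : ℕ) (sg : Bool), Y[p]? = some (Op.read sg i) := by
    intro sg hmem
    rw [List.mem_append] at hmem
    rcases hmem with hmem | hmem
    · obtain ⟨u, hu, he⟩ := List.mem_map.1 hmem
      obtain ⟨p, hp⟩ := List.mem_iff_getElem?.1 hu
      have : u = .read sg i := by
        rcases u with ⟨_ | _, j⟩ | l <;> cases sg <;> simp [Op.toPInstr] at he ⊢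
        · exact Fin.ext he
        · exact Fin.ext he
      exact ⟨p, sg, by rw [hp, this]⟩
    · cases sg <;> simp at hmem
  rcases hi with hi | hi
  · exact hfind true hi
  · exact hfind false hi

theorem two_mul_length_nztShort (n : ℕ) :
    2 * (InSeq.nztShort n).length ≤ 3 * n + 3 := by
  unfold InSeq.nztShort
  split_ifs with h <;> simp <;> omega

theorem encode_eq (Y : List (Op (Fin n))) :
    InSeq.encode (Y.map Op.toPInstr ++ [setOut, .halt]) =
      Y.flatMap (fun u => [u.form, u.num]) ++ [5, -1, 1, -1] := by
  simp only [InSeq.encode, List.flatMap_append, List.flatMap_map, Op.code_toPInstr]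
  congr 1

end NonzeroTest

theorem mainTheorem2 :
    ∃ (P : Ram.Program) (C : ℕ), ∀ n m : ℕ, 0 < n → 0 < m → ∀ X : InSeq.InstrSeq,
      InSeq.Good X →
      X.length = (InSeq.nztShort n).length + m →
      InSeq.iregs X = {i : ℕ+ | (i : ℕ) ≤ n} →
      Ram.DecidesWithin P (InSeq.encode X)
        (C * (2 ^ (6 * m) * (n + m) + n * (n + m)))
        (InSeq.Computes X (InSeq.nzt n)) := by
  open NonzeroTest in
  let P := procedure.code layout 0
  -- each unit of time of the procedure costs at most `P.length` steps
  refine ⟨P, P.length * 1000, fun n m hn hm X hX hlen hreg => ?_⟩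
  obtain ⟨Y, rfl, hread⟩ := exists_abstract hX hreg
  have hshort := two_mul_length_nztShort n
  simp only [List.length_append, List.length_map, List.length_cons, List.length_nil] at hlen
  -- `2 (L + 1) ≤ 3 n + 2 m + 1`, so at most `4 m + 2` registers may be read more than once
  obtain ⟨t, ht, s, hrun, hs⟩ := procedure_ends hread (E := 4 * m + 2) (by omega)
  obtain ⟨t', ht', c, hsteps, hpc, hrep⟩ := hrun.reaches P.length (P := P) (o := 0)
    ⟨[], [], by simp [P], rfl⟩ le_rfl (c := Ram.initial (InSeq.encode
      (Y.map Op.toPInstr ++ [InSeq.setOut, .halt]))) rfl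
    ⟨fun _ => rfl, fun _ _ => rfl, encode_eq Y, rfl⟩
  rw [computes_iff]
  refine ⟨t', ht'.trans ?_, c, hsteps, by simp [hpc, P], fun h => ?_, fun h => ?_⟩
  · rw [mul_assoc]
    refine Nat.mul_le_mul_left _ (ht.trans ?_)
    have h1 : 2 ^ (4 * m + 2) ≤ 2 ^ (6 * m) := Nat.pow_le_pow_right (by norm_num) (by omega)
    have h2 : 1 ≤ 2 ^ (6 * m) := Nat.one_le_two_pow
    have h3 : Y.length + 1 ≤ 3 * (n + m) := by omega
    have h4 : Y.length + n + 1 ≤ 4 * (n + m) := by omega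
    calc 100 * (Y.length + 1) + 2 ^ (4 * m + 2) * (100 * (Y.length + n + 1))
        ≤ 1 * (100 * (3 * (n + m))) + 2 ^ (6 * m) * (100 * (4 * (n + m))) := by
          rw [one_mul]; gcongr
      _ ≤ 2 ^ (6 * m) * (100 * (3 * (n + m))) + 2 ^ (6 * m) * (100 * (4 * (n + m))) := by
          gcongr
      _ = 700 * (2 ^ (6 * m) * (n + m)) := by ring
      _ ≤ 1000 * (2 ^ (6 * m) * (n + m) + n * (n + m)) := by
          gcongr <;> omega
  · rw [hrep.out]; exact hs.1 h
  · rw [hrep.out]; exact hs.2 h
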